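/- **Theorem (Lower bound for $\Lambda_b$ in dimension $d\ge 3$).** Let $d\ge 3$, let $d\sigma$ be the surface measure of the unit sphere $S^{d-1}\subset\mathbb R^d$, and let $b$ be a measurable function, non-negative on $[-1,1]$, such that $$\int_{S^{d-1}} \bigl(1-(\sigma\cdot\sigma')^2\bigr)\, b(\sigma\cdot\sigma')\,d\sigma' <+\infty \qquad\text{for all } \sigma\in S^{d-1}.$$ For smooth functions $f,g$ on $S^{d-1}$ that are even (that is, $f(-\sigma)=f(\sigma)$), put $\Gamma_\Delta(f,g)=\nabla_\sigma f\cdot\nabla_\sigma g$, $$\mathcal B f(\sigma)=\lim_{\varepsilon\to 0^+}\int_{\{|\sigma'\cdot\sigma|<1-\varepsilon\}} \bigl(f(\sigma')-f(\sigma)\bigr)\, b(\sigma'\cdot\sigma)\,d\sigma',$$ $$\Gamma^2_{\mathcal B,\Delta}(f,g)=\tfrac12\bigl(\mathcal B(\Gamma_\Delta(f,g))-\Gamma_\Delta(\mathcal Bf,g)-\Gamma_\Delta(f,\mathcal Bg)\bigr).$$ Then, for every smooth even $g$, the limit defining $\mathcal B g$ exists at every point and $\mathcal B g$ is differentiable;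 and for every smooth even $f\colon S^{d-1}\to(0,\infty)$ the function $\Gamma^2_{\mathcal B,\Delta}(\log f,\log f)\,f$ is integrable. Let $\Lambda_b\in[0,\infty]$ be the supremum of all $\Lambda\in[0,\infty]$ (with $\infty\cdot 0=0$) such that $$\int_{S^{d-1}}\Gamma^2_{\mathcal B,\Delta}(\log f,\log f)\,f\,d\sigma\ \ge\ \Lambda\iint_{S^{d-1}\times S^{d-1}}\frac{(f(\sigma')-f(\sigma))^2}{f(\sigma')+f(\sigma)}\,b(\sigma'\cdot\sigma)\,d\sigma'\,d\sigma$$ for all smooth even functions $f\colon S^{d-1}\to(0,\infty)$. Then this inequality holds for all such $f$ with $\Lambda=\Lambda_b$, and $\Lambda_b\ge d-2$. -/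

import Mathlib

open MeasureTheory Set Filter Topology Module
open scoped ENNReal Manifold ContDiff

noncomputable section

namespace SphereBoltzmann

/-- The Euclidean space `ℝ^d`. -/
abbrev E (d : ℕ) : Type := EuclideanSpace ℝ (Fin d)

/-- The unit sphere `S^{d-1}` of `ℝ^d`. -/
abbrev S (d : ℕ) : Type := Metric.sphere (0 : E d) 1

/-- The surface measure `dσ` of the unit sphere (not normalized). -/
def surf (d : ℕ) : Measure (S d) := (volume : Measure (E d)).toSphere

/-- The scalar product `σ' · σ` of two points of the sphere. -/
def dot {d : ℕ} (σ' σ : S d) : ℝ := inner ℝ (σ' : E d) (σ : E d)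

/-- `f` is a `C^∞` function on the manifold `S^{d-1}`. The number `n` below can only be `d - 1`; it
is introduced because the manifold structure of the sphere is indexed by its dimension. -/
def IsSmooth {d : ℕ} (f : S d → ℝ) : Prop :=
  ∀ (n : ℕ) [Fact (finrank ℝ (E d) = n + 1)], ContMDiff (𝓡 n) 𝓘(ℝ, ℝ) ∞ f

/-- `f (-σ) = f σ`. -/
def IsEven {d : ℕ} (f : S d → ℝ) : Prop := ∀ σ, f (-σ) = f σ

/-- The extension `x ↦ f (x / |x|)` of `f`, homogeneous of degree `0` (with value `0` at `x = 0`). -/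
def homExt {d : ℕ} (f : S d → ℝ) (x : E d) : ℝ :=
  if h : x = 0 then 0 else f ⟨‖x‖⁻¹ • x, by simp [norm_smul, h]⟩

/-- The gradient `∇_σ f` on the sphere, as a vector of `ℝ^d` tangent to the sphere at `σ`: it is the
Euclidean gradient at `σ` of the extension of `f` that is homogeneous of degree `0`. -/
def sphGrad {d : ℕ} (f : S d → ℝ) (σ : S d) : E d := gradient (homExt f) (σ : E d)

/-- The carré du champ `Γ_Δ (f, g) = ∇_σ f · ∇_σ g` of the Laplacian on the sphere. -/
def gammaΔ {d : ℕ} (f g : S d → ℝ) (σ : S d) : ℝ := inner ℝ (sphGrad f σ) (sphGrad g σ)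

/-- The operator `𝓑` for the kernel `b` truncated to `|σ' · σ| < 1 - ε`. -/
def truncB {d : ℕ} (b : ℝ → ℝ) (ε : ℝ) (f : S d → ℝ) (σ : S d) : ℝ :=
  ∫ σ' in {σ' : S d | |dot σ' σ| < 1 - ε}, (f σ' - f σ) * b (dot σ' σ) ∂(surf d)

/-- The spherical linear Boltzmann operator
`𝓑 f (σ) = ∫ (f σ' - f σ) b (σ' · σ) dσ'`. As `b` may be singular at `1` and at `-1`, the
integral is a principal value at `σ' = σ` and `σ' = -σ`. -/
def opB {d : ℕ} (b : ℝ → ℝ) (f : S d → ℝ) (σ : S d) : ℝ :=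
  limUnder (𝓝[>] (0 : ℝ)) fun ε => truncB b ε f σ

/-- The intertwined iterated carré du champ
`Γ²_{𝓑,Δ} (f, g) = 1/2 (𝓑 (Γ_Δ (f, g)) - Γ_Δ (𝓑 f, g) - Γ_Δ (f, 𝓑 g))`. -/
def gammaSq {d : ℕ} (b : ℝ → ℝ) (f g : S d → ℝ) (σ : S d) : ℝ :=
  (1 / 2) * (opB b (gammaΔ f g) σ - gammaΔ (opB b f) g σ - gammaΔ f (opB b g) σ)

/-- A collision kernel: a measurable function `b`, non-negative on `[-1, 1]`. -/
structure IsKernel (b : ℝ → ℝ) : Prop where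
  measurable : Measurable b
  nonneg : ∀ c ∈ Icc (-1 : ℝ) 1, 0 ≤ b c

/-- For all `σ`, `∫ (1 - (σ · σ')²) b (σ · σ') dσ' < ∞`. -/
def LevyCondition (d : ℕ) (b : ℝ → ℝ) : Prop :=
  ∀ σ : S d, ∫⁻ σ', ENNReal.ofReal ((1 - dot σ σ' ^ 2) * b (dot σ σ')) ∂(surf d) < ⊤

/-- The integrand `Γ²_{𝓑,Δ} (log f, log f) f`. -/
def entropyIntegrand {d : ℕ} (b : ℝ → ℝ) (f : S d → ℝ) (σ : S d) : ℝ :=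
  gammaSq b (fun τ => Real.log (f τ)) (fun τ => Real.log (f τ)) σ * f σ

/-- The double integral `∬ (f σ' - f σ)² / (f σ' + f σ) b (σ' · σ) dσ' dσ`, in `[0, ∞]`. -/
def jumpEnergy {d : ℕ} (b : ℝ → ℝ) (f : S d → ℝ) : ℝ≥0∞ :=
  ∫⁻ σ, ∫⁻ σ', ENNReal.ofReal ((f σ' - f σ) ^ 2 / (f σ' + f σ) * b (dot σ' σ))
    ∂(surf d) ∂(surf d)

/-- The log-Sobolev inequality with the constant `Λ ∈ [0, ∞]`, for all smooth positive even
functions on `S^{d-1}`. -/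
def LogSobolev (d : ℕ) (b : ℝ → ℝ) (Λ : ℝ≥0∞) : Prop :=
  ∀ f : S d → ℝ, IsSmooth f → IsEven f → (∀ σ, 0 < f σ) →
    ((Λ * jumpEnergy b f : ℝ≥0∞) : EReal) ≤ ((∫ σ, entropyIntegrand b f σ ∂(surf d) : ℝ) : EReal)

/-- The optimal constant `Λ_b` in the log-Sobolev inequality (it is `∞` for `b = 0`). -/
def optConst (d : ℕ) (b : ℝ → ℝ) : ℝ≥0∞ := sSup {Λ | LogSobolev d b Λ}

end SphereBoltzmann

end

open SphereBoltzmann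

/-!
The operator `𝓑` commutes with rotations, hence with the derivatives `X_ij = x_i ∂_j - x_j ∂_i` along
the infinitesimal rotations (`fderiv_opB_skew`). As `Γ_Δ (g, g) = ½ ∑ (X_ij g)²` on the sphere, the
iterated carré du champ is a sum of squares,
`Γ²_{𝓑,Δ} (g, g) (σ) = ½ ∫ Q (σ, σ') b (σ' · σ) dσ'` with
`Q (σ, σ') = ½ ∑ (X_ij g (σ') - X_ij g (σ))²` (`ofReal_gammaSq`), and by symmetry
`∫ Γ²_{𝓑,Δ} (log f, log f) f = ¼ ∬ (f + f') Q b`, where `f = f (σ)`, `f' = f (σ')` and `g = log f`.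

The kernel depends on `σ' · σ` only, so both double integrals are unchanged if their integrands are
averaged over the orthogonal group (`IsInvariantFamily.lintegral_pair_eq`). It is thus enough to
compare `¼ (f + f') Q` and `(f' - f)² / (f' + f)` in mean over all rotations of one fixed pair
`σ = α m + β u`, `σ' = α m - β u`, with `m`, `u` orthonormal; by evenness one may take `σ · σ' ≥ 0`.
Let `e_1, …, e_{d-2}` complete `m`, `u` to an orthonormal basis. Then `Q` is at least
`2 β² ∑ ((∂_{e_i} g (σ))² + (∂_{e_i} g (σ'))²)` (`rotEnergy_ge`). For each `i`, rotate the pair in the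
plane of `u` and `e_i`: half a turn exchanges the two points, and along the resulting circle, with
`F (t) = f (σ (t))` and `F₁ (t) = F (t + π)`, Wirtinger's inequality for the antiperiodic function
`(F - F₁) / √(F + F₁)` and an elementary pointwise bound (`two_mul_sq_deriv_le`) give
`∫ (F - F₁)² / (F + F₁) ≤ ½ ∫ (F + F₁) ((F' / F)² + (F₁' / F₁)²)` (`circle_inequality`). Summing over
the `d - 2` directions produces the constant `d - 2` (`IsInvariantFamily.lintegral_pair_le`).

For the regularity statements, a smooth even function is extended to `ℝ^d ∖ {0}` as a smooth function
with `h (c x) = h x`. After symmetrization by the reflection through the line `ℝσ`, the integrand of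
`𝓑 h (σ)` is a second difference of `h`, which is `O (1 - (σ' · σ)²)` because evenness makes the point
`-σ` as harmless as `σ` (`exists_secondDiff_le`). This bound gives the principal value by dominated
convergence. It holds locally uniformly for the derivative of `h (A σ')` with respect to the linear
map `A`, so the integral can be differentiated under the sign (`EvenHom.hasFDerivAt_transportedB`).
In particular `𝓑 h` is continuous, and so is the entropy integrand, by the sum of squares formula.
-/

namespace SphereBoltzmann

/-! ### Isometries acting on the sphere -/

section

variable {d : ℕ}

/-- The map of the sphere induced by a linear isometry of `ℝ^d`. -/
noncomputable def sphMap (L : E d ≃ₗᵢ[ℝ] E d) (σ : S d) : S d :=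
  ⟨L σ, by simp⟩

@[simp] lemma coe_sphMap (L : E d ≃ₗᵢ[ℝ] E d) (σ : S d) : (sphMap L σ : E d) = L σ := rfl

lemma norm_coe_S (σ : S d) : ‖(σ : E d)‖ = 1 := by simp

lemma coe_S_ne_zero (σ : S d) : (σ : E d) ≠ 0 := by
  intro h
  have := norm_coe_S σ
  simp [h] at this

lemma continuous_sphMap (L : E d ≃ₗᵢ[ℝ] E d) : Continuous (sphMap L) :=
  (L.continuous.comp continuous_subtype_val).subtype_mk _

lemma dot_sphMap (L : E d ≃ₗᵢ[ℝ] E d) (σ τ : S d) : dot (sphMap L σ) (sphMap L τ) = dot σ τ := by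
  simp [dot]

lemma dot_comm (σ τ : S d) : dot σ τ = dot τ σ := real_inner_comm _ _

lemma abs_dot_le_one (σ τ : S d) : |dot σ τ| ≤ 1 := by
  simpa [dot] using abs_real_inner_le_norm (σ : E d) (τ : E d)

lemma dot_mem_Icc (σ τ : S d) : dot σ τ ∈ Icc (-1 : ℝ) 1 := abs_le.1 (abs_dot_le_one σ τ)

lemma one_sub_dot_sq_nonneg (σ τ : S d) : 0 ≤ 1 - dot σ τ ^ 2 := by
  have := dot_mem_Icc σ τ
  nlinarith [this.1, this.2]

lemma continuous_dot : Continuous fun p : S d × S d => dot p.1 p.2 :=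
  (continuous_subtype_val.comp continuous_fst).inner (continuous_subtype_val.comp continuous_snd)

lemma continuous_dot_left (σ : S d) : Continuous fun τ : S d => dot τ σ :=
  continuous_dot.comp (continuous_id.prodMk continuous_const)

/-- The surface measure is invariant under linear isometries. -/
lemma measurePreserving_sphMap (L : E d ≃ₗᵢ[ℝ] E d) :
    MeasurePreserving (sphMap L) (surf d) (surf d) := by
  refine ⟨(continuous_sphMap L).measurable, ?_⟩
  ext s hs
  rw [Measure.map_apply (continuous_sphMap L).measurable hs, surf,
    Measure.toSphere_apply' _ hs,
    Measure.toSphere_apply' _ ((continuous_sphMap L).measurable hs)]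
  congr 1
  conv_rhs => rw [← L.measurePreserving.measure_preimage_equiv (f := L.toMeasurableEquiv)]
  congr 1
  ext x
  constructor
  · rintro ⟨r, hr, _, ⟨σ, hσ, rfl⟩, rfl⟩
    exact ⟨r, hr, _, ⟨_, hσ, rfl⟩, by simp⟩
  · rintro ⟨r, hr, _, ⟨σ, hσ, rfl⟩, h⟩
    refine ⟨r, hr, _, ⟨sphMap L.symm σ, ?_, rfl⟩, ?_⟩
    · have : sphMap L (sphMap L.symm σ) = σ := Subtype.ext (by simp)
      simpa [this] using hσ
    · apply L.injective
      simpa using h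

instance : IsFiniteMeasure (surf d) := by unfold surf; infer_instance

/-- The orthogonal reflection of `ℝ^d` through the line spanned by `w`. -/
noncomputable def lineRefl (w : E d) : E d ≃ₗᵢ[ℝ] E d := (ℝ ∙ w).reflection

lemma lineRefl_apply (w z : E d) :
    lineRefl w z = (2 * (inner ℝ w z / ‖w‖ ^ 2)) • w - z := by
  rw [lineRefl, Submodule.reflection_singleton_apply, mul_smul, two_smul, two_smul]
  simp

lemma lineRefl_apply_of_norm {w : E d} (hw : ‖w‖ = 1) (z : E d) :
    lineRefl w z = (2 * inner ℝ w z) • w - z := by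
  simp [lineRefl_apply, hw]

@[simp] lemma lineRefl_lineRefl (w z : E d) : lineRefl w (lineRefl w z) = z :=
  Submodule.reflection_reflection _ z

lemma lineRefl_self (σ : S d) : lineRefl (σ : E d) σ = σ := by
  rw [lineRefl_apply_of_norm (by simp)]
  simp [two_smul]

lemma dot_lineRefl (σ τ : S d) : dot (sphMap (lineRefl (σ : E d)) τ) σ = dot τ σ := by
  calc inner ℝ (lineRefl (σ : E d) τ) (σ : E d)
      = inner ℝ (lineRefl (σ : E d) τ) (lineRefl (σ : E d) σ) := by rw [lineRefl_self]
    _ = _ := by rw [LinearIsometryEquiv.inner_map_map]; rfl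

/-- Reflections through lines are conjugate under isometries. -/
lemma lineRefl_map (L : E d ≃ₗᵢ[ℝ] E d) (w z : E d) :
    lineRefl (L w) (L z) = L (lineRefl w z) := by
  simp [lineRefl_apply]

/-! ### Even functions homogeneous of degree zero -/

/-- Functions on `ℝ^d` which are smooth off the origin and satisfy `h (c x) = h x` for all `c ≠ 0`.
These are the extensions, homogeneous of degree `0`, of the smooth even functions on the sphere;
nothing is asked about regularity at the origin. -/
structure EvenHom (h : E d → ℝ) : Prop where
  contDiffAt : ∀ x, x ≠ 0 → ContDiffAt ℝ ∞ h x
  hom : ∀ (c : ℝ) (x : E d), c ≠ 0 → h (c • x) = h x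

lemma homExt_of_ne {f : S d → ℝ} {x : E d} (hx : x ≠ 0) :
    homExt f x = f ⟨‖x‖⁻¹ • x, by simp [norm_smul, hx]⟩ := dif_neg hx

lemma homExt_coe (f : S d → ℝ) (σ : S d) : homExt f σ = f σ := by
  rw [homExt_of_ne (coe_S_ne_zero σ)]
  congr 1
  exact Subtype.ext (by simp)

namespace EvenHom

variable {h k : E d → ℝ}

lemma differentiableAt (hh : EvenHom h) {x : E d} (hx : x ≠ 0) : DifferentiableAt ℝ h x :=
  (hh.contDiffAt x hx).differentiableAt (by simp)

lemma neg_apply (hh : EvenHom h) (x : E d) : h (-x) = h x := by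
  simpa using hh.hom (-1) x (by norm_num)

lemma mul (hh : EvenHom h) (hk : EvenHom k) : EvenHom fun x => h x * k x :=
  ⟨fun x hx => (hh.contDiffAt x hx).mul (hk.contDiffAt x hx), fun c x hc => by
    rw [hh.hom c x hc, hk.hom c x hc]⟩

lemma const (c : ℝ) : EvenHom fun _ : E d => c := ⟨fun _ _ => contDiffAt_const, fun _ _ _ => rfl⟩

lemma sum {ι : Type*} {s : Finset ι} {h : ι → E d → ℝ} (hh : ∀ i, EvenHom (h i)) :
    EvenHom fun x => ∑ i ∈ s, h i x :=
  ⟨fun x hx => ContDiffAt.sum fun i _ => (hh i).contDiffAt x hx, fun c x hc => by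
    simp only [fun i => (hh i).hom c x hc]⟩

lemma fderiv_smul (hh : EvenHom h) {c : ℝ} (hc : c ≠ 0) (x : E d) :
    fderiv ℝ h (c • x) = c⁻¹ • fderiv ℝ h x := by
  have h1 : (fun y => h (c • y)) = h := funext fun y => hh.hom c y hc
  have h2 := congrArg (fun F => fderiv ℝ F x) h1
  simp only [fderiv_comp_smul] at h2
  rw [← h2, smul_smul, inv_mul_cancel₀ hc, one_smul]

/-- The derivative of `h` along a linear vector field `x ↦ A x` is again smooth, even and
homogeneous of degree `0`. -/
lemma fderiv_apply (hh : EvenHom h) (A : E d →L[ℝ] E d) :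
    EvenHom fun x => fderiv ℝ h x (A x) := by
  refine ⟨fun x hx => ?_, fun c x hc => ?_⟩
  · exact ((hh.contDiffAt x hx).fderiv_right (m := ∞) (by simp)).clm_apply A.contDiff.contDiffAt
  · simp [hh.fderiv_smul hc, hc]

lemma fderiv_self (hh : EvenHom h) {x : E d} (hx : x ≠ 0) : fderiv ℝ h x x = 0 := by
  have h1 : HasDerivAt (fun t : ℝ => h (t • x)) (fderiv ℝ h x x) 1 := by
    have h2 : HasDerivAt (fun t : ℝ => t • x) x 1 := by
      simpa using (hasDerivAt_id (1 : ℝ)).smul_const x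
    have h3 : HasFDerivAt h (fderiv ℝ h x) ((1 : ℝ) • x) := by
      rw [one_smul]; exact (hh.differentiableAt hx).hasFDerivAt
    exact h3.comp_hasDerivAt 1 h2
  have h4 : (fun t : ℝ => h (t • x)) =ᶠ[𝓝 1] fun _ => h x := by
    filter_upwards [isOpen_ne.mem_nhds (one_ne_zero : (1 : ℝ) ≠ 0)] with t ht
    exact hh.hom t x ht
  exact h1.unique ((hasDerivAt_const (1 : ℝ) (h x)).congr_of_eventuallyEq h4)

lemma eq_homExt (hh : EvenHom h) {x : E d} (hx : x ≠ 0) :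
    homExt (fun σ : S d => h σ) x = h x := by
  rw [homExt_of_ne hx]
  exact hh.hom _ _ (by simpa using hx)

lemma eventuallyEq_homExt (hh : EvenHom h) {x : E d} (hx : x ≠ 0) :
    homExt (fun σ : S d => h σ) =ᶠ[𝓝 x] h := by
  filter_upwards [isOpen_ne.mem_nhds hx] with y hy using hh.eq_homExt hy

lemma inner_sphGrad (hh : EvenHom h) (σ : S d) (e : E d) :
    inner ℝ (sphGrad (fun τ : S d => h τ) σ) e = fderiv ℝ h σ e := by
  rw [sphGrad, gradient, InnerProductSpace.toDual_symm_apply,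
    (hh.eventuallyEq_homExt (coe_S_ne_zero σ)).fderiv_eq]

lemma continuous_coe (hh : EvenHom h) : Continuous fun σ : S d => h σ :=
  continuous_iff_continuousAt.2 fun σ =>
    (hh.contDiffAt σ (coe_S_ne_zero σ)).continuousAt.comp continuous_subtype_val.continuousAt

lemma log (hh : EvenHom h) (hpos : ∀ x, x ≠ 0 → 0 < h x) : EvenHom fun x => Real.log (h x) :=
  ⟨fun x hx => (hh.contDiffAt x hx).log (hpos x hx).ne', fun c x hc => by rw [hh.hom c x hc]⟩

end EvenHom

/-- The homogeneous extension of a smooth even function on the sphere is smooth off the origin. -/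
lemma IsSmooth.evenHom {f : S d → ℝ} (hf : IsSmooth f) (he : IsEven f) : EvenHom (homExt f) := by
  refine ⟨fun x hx => ?_, fun c x hc => ?_⟩
  · obtain ⟨n, hn⟩ : ∃ n, d = n + 1 := by
      refine Nat.exists_eq_succ_of_ne_zero ?_
      rintro rfl
      exact hx (Subsingleton.elim _ _)
    have : Fact (finrank ℝ (E d) = n + 1) := ⟨by simp [hn]⟩
    have hfs := hf n
    let U : TopologicalSpace.Opens (E d) := ⟨{0}ᶜ, isOpen_compl_singleton⟩
    have hU : ∀ y : U, (y : E d) ≠ 0 := fun y => y.2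
    have h1 : ContMDiff 𝓘(ℝ, E d) 𝓘(ℝ, E d) ∞ (fun y : U => ‖(y : E d)‖⁻¹ • (y : E d)) := by
      intro y
      rw [contMDiffAt_subtype_iff (f := fun y : E d => ‖y‖⁻¹ • y), contMDiffAt_iff_contDiffAt]
      exact ((contDiffAt_norm ℝ (hU y)).inv (by simpa using hU y)).smul contDiffAt_id
    have h2 := hfs.comp (h1.codRestrict_sphere (n := n)
      (fun y => by simp [norm_smul, hU y]))
    have h3 := h2 ⟨x, hx⟩
    have h4 : (f ∘ fun y : U => (⟨‖(y : E d)‖⁻¹ • (y : E d), by simp [norm_smul, hU y]⟩ : S d))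
        = fun y : U => homExt f y := by
      funext y
      rw [homExt_of_ne (hU y)]
      rfl
    have h5 : ContMDiffAt 𝓘(ℝ, E d) 𝓘(ℝ, ℝ) ∞ (fun y : U => homExt f y) ⟨x, hx⟩ := by
      rw [← h4]; exact h3
    rw [contMDiffAt_subtype_iff (f := homExt f), contMDiffAt_iff_contDiffAt] at h5
    exact h5
  · rcases eq_or_ne x 0 with rfl | hx
    · simp
    · have hcx : c • x ≠ 0 := smul_ne_zero hc hx
      rw [homExt_of_ne hcx, homExt_of_ne hx]
      rcases lt_or_gt_of_ne hc with hneg | hpos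
      · rw [← he]
        congr 1
        apply Subtype.ext
        simp only [norm_smul, Real.norm_eq_abs, abs_of_neg hneg, mul_inv, smul_smul]
        change -((((-c)⁻¹ * ‖x‖⁻¹) * c) • x) = ‖x‖⁻¹ • x
        rw [← neg_smul]
        congr 1
        field_simp
      · congr 1
        apply Subtype.ext
        simp only [norm_smul, Real.norm_eq_abs, abs_of_pos hpos, mul_inv, smul_smul]
        congr 1
        field_simp

end

/-! ### Bounds on symmetric second differences -/

section

variable {d : ℕ}

/-- A `C^2` function of `(x, v)` which is even in `v` and vanishes for `v = 0` is `O(‖v‖²)`, locally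
uniformly in `x`. -/
lemma exists_norm_le_sq_of_even {X V F : Type*} [NormedAddCommGroup X] [NormedSpace ℝ X]
    [NormedAddCommGroup V] [NormedSpace ℝ V] [NormedAddCommGroup F] [NormedSpace ℝ F]
    {χ : X × V → F} {x₀ : X} (hχ : ContDiffAt ℝ 2 χ (x₀, 0))
    (heven : ∀ x v, χ (x, -v) = χ (x, v)) (hzero : ∀ x, χ (x, 0) = 0) :
    ∃ K : ℝ, ∀ᶠ p in 𝓝 (x₀, (0 : V)), ‖χ p‖ ≤ K * ‖p.2‖ ^ 2 := by
  have h1 : ContDiffAt ℝ 1 (fderiv ℝ χ) (x₀, 0) := hχ.fderiv_right (by norm_num)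
  obtain ⟨K, t, ht, hK⟩ := h1.exists_lipschitzOnWith
  have h2 : ∀ᶠ p in 𝓝 (x₀, (0 : V)), DifferentiableAt ℝ χ p :=
    (hχ.eventually (by simp)).mono fun p hp => hp.differentiableAt (by simp)
  obtain ⟨r, hr, hball⟩ := Metric.mem_nhds_iff.1 (inter_mem ht h2)
  refine ⟨K, ?_⟩
  filter_upwards [Metric.ball_mem_nhds _ hr] with ⟨x, v⟩ hp
  have hx : ‖x - x₀‖ < r ∧ ‖v‖ < r := by
    rw [Metric.mem_ball, dist_eq_norm, Prod.mk_sub_mk, sub_zero, Prod.norm_def, max_lt_iff] at hp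
    exact hp
  have hmem : ∀ w : V, ‖w‖ ≤ ‖v‖ → (x, w) ∈ t ∧ DifferentiableAt ℝ χ (x, w) := by
    intro w hw
    apply hball
    rw [Metric.mem_ball, dist_eq_norm, Prod.mk_sub_mk, sub_zero, Prod.norm_def, max_lt_iff]
    exact ⟨hx.1, hw.trans_lt hx.2⟩
  have hder : ∀ w : V, ‖w‖ ≤ ‖v‖ → HasFDerivAt (fun w => χ (x, w))
      ((fderiv ℝ χ (x, w)).comp (ContinuousLinearMap.inr ℝ X V)) w := fun w hw =>
    (hmem w hw).2.hasFDerivAt.comp w (hasFDerivAt_prodMk_right x w)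
  have hd0 : (fderiv ℝ χ (x, 0)).comp (ContinuousLinearMap.inr ℝ X V) = 0 := by
    have ha := hder 0 (by simp)
    have hb : HasFDerivAt (fun w => χ (x, w))
        (-(fderiv ℝ χ (x, 0)).comp (ContinuousLinearMap.inr ℝ X V)) 0 := by
      have hc : HasFDerivAt (fun w => χ (x, w))
        ((fderiv ℝ χ (x, 0)).comp (ContinuousLinearMap.inr ℝ X V)) (-(0 : V)) := by simpa using ha
      have hd := hc.comp (0 : V) ((hasFDerivAt_id (𝕜 := ℝ) (0 : V)).neg)
      refine (hd.congr_fderiv ?_).congr_of_eventuallyEq ?_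
      · ext; simp
      · exact Eventually.of_forall fun w => (heven x w).symm
    have := ha.unique hb
    have h3 := add_eq_zero_iff_eq_neg.2 this
    rw [← two_smul ℝ] at h3
    exact (smul_eq_zero.1 h3).resolve_left two_ne_zero
  have hbound : ∀ w ∈ Metric.closedBall (0 : V) ‖v‖,
      ‖(fderiv ℝ χ (x, w)).comp (ContinuousLinearMap.inr ℝ X V)‖ ≤ K * ‖v‖ := by
    intro w hw
    have hw' : ‖w‖ ≤ ‖v‖ := by simpa using hw
    have h3 := hK.norm_sub_le (hmem w hw').1 (hmem 0 (by simp)).1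
    rw [Prod.mk_sub_mk, sub_self, sub_zero, Prod.norm_def] at h3
    simp only [norm_zero, norm_nonneg, sup_of_le_right] at h3
    calc ‖(fderiv ℝ χ (x, w)).comp (ContinuousLinearMap.inr ℝ X V)‖
        = ‖(fderiv ℝ χ (x, w) - fderiv ℝ χ (x, 0)).comp (ContinuousLinearMap.inr ℝ X V)‖ := by
          rw [ContinuousLinearMap.sub_comp, hd0, sub_zero]
      _ ≤ ‖fderiv ℝ χ (x, w) - fderiv ℝ χ (x, 0)‖ * 1 :=
          (ContinuousLinearMap.opNorm_comp_le _ _).trans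
            (mul_le_mul_of_nonneg_left (ContinuousLinearMap.norm_inr_le_one ℝ X V) (norm_nonneg _))
      _ ≤ K * ‖v‖ := by
          rw [mul_one]
          exact h3.trans (mul_le_mul_of_nonneg_left hw' K.2)
  have h4 := (convex_closedBall (0 : V) ‖v‖).norm_image_sub_le_of_norm_hasFDerivWithin_le
    (fun w hw => (hder w (by simpa using hw)).hasFDerivWithinAt) hbound
    (x := 0) (y := v) (by simp) (by simp)
  rw [hzero, sub_zero, sub_zero] at h4
  calc ‖χ (x, v)‖ ≤ K * ‖v‖ * ‖v‖ := h4
    _ = K * ‖v‖ ^ 2 := by ring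

/-- The symmetric second difference at `σ` of a `C^2` function which is even and homogeneous of
degree `0` is `O(1 - (z · σ)²)`, uniformly in `z` on the sphere and locally uniformly in a
parameter. -/
lemma exists_secondDiff_le {X F : Type*} [NormedAddCommGroup X] [NormedSpace ℝ X]
    [NormedAddCommGroup F] [NormedSpace ℝ F] {Ψ : X → E d → F} {x₀ : X}
    (hΨ : ∀ z, z ≠ 0 → ContDiffAt ℝ 2 (fun p : X × E d => Ψ p.1 p.2) (x₀, z))
    (hhom : ∀ x z (c : ℝ), c ≠ 0 → Ψ x (c • z) = Ψ x z) (σ : S d) :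
    ∃ C : ℝ, ∀ᶠ x in 𝓝 x₀, ∀ z : S d,
      ‖Ψ x z + Ψ x (lineRefl (σ : E d) z) - (2 : ℝ) • Ψ x σ‖ ≤ C * (1 - dot z σ ^ 2) := by
  have key := (isCompact_univ (X := S d)).induction_on (p := fun s => ∃ C : ℝ, ∀ᶠ x in 𝓝 x₀,
    ∀ z ∈ s, ‖Ψ x z + Ψ x (lineRefl (σ : E d) z) - (2 : ℝ) • Ψ x σ‖ ≤ C * (1 - dot z σ ^ 2))
    ⟨0, by simp⟩ (fun s t hst ⟨C, hC⟩ => ⟨C, hC.mono fun x hx z hz => hx z (hst hz)⟩) ?_ ?_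
  · obtain ⟨C, hC⟩ := key
    exact ⟨C, hC.mono fun x hx z => hx z (mem_univ z)⟩
  · rintro s t ⟨C, hC⟩ ⟨C', hC'⟩
    refine ⟨max C C', ?_⟩
    filter_upwards [hC, hC'] with x hx hx' z hz
    have := one_sub_dot_sq_nonneg z σ
    rcases hz with hz | hz
    · exact (hx z hz).trans (mul_le_mul_of_nonneg_right (le_max_left _ _) this)
    · exact (hx' z hz).trans (mul_le_mul_of_nonneg_right (le_max_right _ _) this)
  intro z₀ _
  simp only [nhdsWithin_univ]
  -- it suffices to bound on a neighbourhood of `(x₀, z₀)`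
  suffices h : ∃ C : ℝ, ∀ᶠ p : X × S d in 𝓝 (x₀, z₀),
      ‖Ψ p.1 p.2 + Ψ p.1 (lineRefl (σ : E d) p.2) - (2 : ℝ) • Ψ p.1 σ‖
        ≤ C * (1 - dot p.2 σ ^ 2) by
    obtain ⟨C, hC⟩ := h
    rw [nhds_prod_eq] at hC
    obtain ⟨u, hu, t, ht, hut⟩ := Filter.eventually_prod_iff.1 hC
    exact ⟨{z | t z}, ht, C, hu.mono fun x hx z hz => hut hx hz⟩
  have hc : Continuous fun p : X × S d => dot p.2 σ := (continuous_dot_left σ).comp continuous_snd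
  rcases (one_sub_dot_sq_nonneg z₀ σ).lt_or_eq with hlt | heq
  · -- away from `±σ` boundedness is enough
    have hcont : ContinuousAt (fun p : X × S d =>
        ‖Ψ p.1 p.2 + Ψ p.1 (lineRefl (σ : E d) p.2) - (2 : ℝ) • Ψ p.1 σ‖) (x₀, z₀) := by
      have hgen : ∀ g : S d → E d, Continuous g → g z₀ ≠ 0 →
          ContinuousAt (fun p : X × S d => Ψ p.1 (g p.2)) (x₀, z₀) := by
        intro g hg hg0
        have h1 : ContinuousAt (fun p : X × S d => (p.1, g p.2)) (x₀, z₀) := by fun_prop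
        exact ContinuousAt.comp (f := fun p : X × S d => (p.1, g p.2))
          (g := fun p : X × E d => Ψ p.1 p.2) (hΨ _ hg0).continuousAt h1
      refine (((hgen _ continuous_subtype_val (coe_S_ne_zero _)).add
        (hgen (fun z => lineRefl (σ : E d) z) ((lineRefl (σ : E d)).continuous.comp
          continuous_subtype_val) ?_)).sub ((hgen (fun _ => (σ : E d)) continuous_const
          (coe_S_ne_zero _)).const_smul (2 : ℝ))).norm
      simpa using coe_S_ne_zero z₀
    set M := ‖Ψ x₀ z₀ + Ψ x₀ (lineRefl (σ : E d) z₀) - (2 : ℝ) • Ψ x₀ σ‖ with hM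
    have hκ : 0 < (1 - dot z₀ σ ^ 2) / 2 := by positivity
    refine ⟨(M + 1) / ((1 - dot z₀ σ ^ 2) / 2), ?_⟩
    have e1 := hcont.eventually (gt_mem_nhds (show M < M + 1 by linarith))
    have e2 : ∀ᶠ p : X × S d in 𝓝 (x₀, z₀), (1 - dot z₀ σ ^ 2) / 2 < 1 - dot p.2 σ ^ 2 :=
      ((continuous_const.sub (hc.pow 2)).continuousAt (x := (x₀, z₀))).eventually
        (lt_mem_nhds (show (1 - dot z₀ σ ^ 2) / 2 < 1 - dot z₀ σ ^ 2 by linarith))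
    filter_upwards [e1, e2] with p hp1 hp2
    have hM0 : 0 ≤ M := norm_nonneg _
    rw [div_mul_eq_mul_div, le_div_iff₀ hκ]
    have h0 := norm_nonneg (Ψ p.1 p.2 + Ψ p.1 (lineRefl (σ : E d) p.2) - (2 : ℝ) • Ψ p.1 σ)
    exact mul_le_mul hp1.le hp2.le hκ.le (by linarith)
  · -- near `±σ` write `z = c (σ + v)` with `c = z · σ` and expand in `v`
    have hc0 : dot z₀ σ ^ 2 = 1 := by linarith
    have hc0' : dot z₀ σ ≠ 0 := by
      intro h
      rw [h] at hc0
      norm_num at hc0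
    have hnorm : ∀ z : S d, ‖(z : E d) - dot z σ • (σ : E d)‖ ^ 2 = 1 - dot z σ ^ 2 := by
      intro z
      rw [norm_sub_sq_real, inner_smul_right, norm_smul, norm_coe_S, norm_coe_S, Real.norm_eq_abs,
        mul_one, sq_abs]
      change 1 ^ 2 - 2 * (dot z σ * dot z σ) + _ = _
      ring
    set χ : X × E d → F := fun p => Ψ p.1 (σ + p.2) + Ψ p.1 (σ - p.2) - (2 : ℝ) • Ψ p.1 σ with hχdef
    have hχ : ContDiffAt ℝ 2 χ (x₀, 0) := by
      have hgen : ∀ g : E d → E d, ContDiff ℝ 2 g → g 0 = σ →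
          ContDiffAt ℝ 2 (fun p : X × E d => Ψ p.1 (g p.2)) (x₀, 0) := by
        intro g hg hg0
        have h1 : ContDiffAt ℝ 2 (fun p : X × E d => (p.1, g p.2)) (x₀, 0) :=
          contDiffAt_fst.prodMk (hg.contDiffAt.comp _ contDiffAt_snd)
        exact ContDiffAt.comp (x₀, (0 : E d)) (f := fun p : X × E d => (p.1, g p.2))
          (g := fun p : X × E d => Ψ p.1 p.2)
          (by simpa [hg0] using hΨ _ (coe_S_ne_zero σ)) h1
      exact ((hgen _ (contDiff_const.add contDiff_id) (by simp)).add
        (hgen _ (contDiff_const.sub contDiff_id) (by simp))).sub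
        ((hgen _ contDiff_const rfl).const_smul (2 : ℝ))
    obtain ⟨K, hK⟩ := exists_norm_le_sq_of_even hχ
      (fun x v => by simp only [hχdef, sub_neg_eq_add, ← sub_eq_add_neg]; abel)
      (fun x => by simp [hχdef, two_smul])
    let v : S d → E d := fun z => (dot z σ)⁻¹ • (z : E d) - σ
    have hv0 : v z₀ = 0 := by
      have h1 : (z₀ : E d) - dot z₀ σ • (σ : E d) = 0 := by
        have := hnorm z₀
        rw [hc0, sub_self] at this
        simpa using this
      have h2 : (z₀ : E d) = dot z₀ σ • (σ : E d) := sub_eq_zero.1 h1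
      have h3 : (dot z₀ σ)⁻¹ • (z₀ : E d) = σ := by
        rw [inv_smul_eq_iff₀ hc0', h2]
      exact sub_eq_zero.2 h3
    have hvcont : ContinuousAt (fun p : X × S d => (p.1, v p.2)) (x₀, z₀) := by
      refine continuousAt_fst.prodMk ?_
      exact ((hc.continuousAt.inv₀ hc0').smul
        (continuous_subtype_val.comp continuous_snd).continuousAt).sub continuousAt_const
    have e1 : ∀ᶠ p : X × S d in 𝓝 (x₀, z₀), ‖χ (p.1, v p.2)‖ ≤ K * ‖v p.2‖ ^ 2 := by
      have : Tendsto (fun p : X × S d => (p.1, v p.2)) (𝓝 (x₀, z₀)) (𝓝 (x₀, 0)) := by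
        have := hvcont.tendsto
        simpa only [hv0] using this
      exact this.eventually hK
    have e2 : ∀ᶠ p : X × S d in 𝓝 (x₀, z₀), 1 / 2 < dot p.2 σ ^ 2 :=
      ((hc.pow 2).continuousAt (x := (x₀, z₀))).eventually
        (lt_mem_nhds (by simpa [hc0] using by norm_num))
    refine ⟨|K| * 2, ?_⟩
    filter_upwards [e1, e2] with ⟨x, z⟩ h1 h2
    simp only at h1 h2 ⊢
    have hcz : dot z σ ≠ 0 := by
      intro h
      rw [h] at h2
      norm_num at h2
    have hz1 : Ψ x (σ + v z) = Ψ x z := by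
      simp only [v, add_sub_cancel]
      exact hhom _ _ _ (inv_ne_zero hcz)
    have hz2 : Ψ x (σ - v z) = Ψ x (lineRefl (σ : E d) z) := by
      rw [← hhom x (σ - v z) (dot z σ) hcz]
      congr 1
      rw [lineRefl_apply_of_norm (norm_coe_S σ), real_inner_comm]
      change _ = (2 * dot z σ) • (σ : E d) - z
      simp only [v]
      rw [smul_sub, smul_sub, smul_smul, mul_inv_cancel₀ hcz, one_smul, two_mul, add_smul]
      abel
    have hvn : ‖v z‖ ^ 2 = (1 - dot z σ ^ 2) / dot z σ ^ 2 := by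
      have : v z = (dot z σ)⁻¹ • ((z : E d) - dot z σ • (σ : E d)) := by
        simp only [v]
        rw [smul_sub, smul_smul, inv_mul_cancel₀ hcz, one_smul]
      rw [this, norm_smul, mul_pow, hnorm, norm_inv, Real.norm_eq_abs, inv_pow, sq_abs]
      field_simp
    simp only [hχdef, hz1, hz2] at h1
    refine h1.trans ?_
    have h3 : ‖v z‖ ^ 2 ≤ 2 * (1 - dot z σ ^ 2) := by
      rw [hvn, div_le_iff₀ (by positivity)]
      nlinarith [one_sub_dot_sq_nonneg z σ]
    calc K * ‖v z‖ ^ 2 ≤ |K| * ‖v z‖ ^ 2 :=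
          mul_le_mul_of_nonneg_right (le_abs_self K) (by positivity)
      _ ≤ |K| * (2 * (1 - dot z σ ^ 2)) := mul_le_mul_of_nonneg_left h3 (abs_nonneg K)
      _ = _ := by ring

end

/-! ### The principal value -/

section

variable {d : ℕ} {b : ℝ → ℝ}

lemma measurableEmbedding_sphMap (L : E d ≃ₗᵢ[ℝ] E d) : MeasurableEmbedding (sphMap L) :=
  (continuous_sphMap L).measurableEmbedding fun _ _ h =>
    Subtype.ext (L.injective (congrArg Subtype.val h))

lemma IsKernel.measurable_dot (hb : IsKernel b) (σ : S d) : Measurable fun z : S d => b (dot z σ) :=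
  hb.measurable.comp (continuous_dot_left σ).measurable

lemma IsKernel.dot_nonneg (hb : IsKernel b) (z σ : S d) : 0 ≤ b (dot z σ) :=
  hb.nonneg _ (dot_mem_Icc z σ)

lemma LevyCondition.integrable (hb : IsKernel b) (hl : LevyCondition d b) (σ : S d) :
    Integrable (fun z : S d => (1 - dot z σ ^ 2) * b (dot z σ)) (surf d) := by
  refine ⟨((measurable_const.sub ((continuous_dot_left σ).measurable.pow_const 2)).mul
    (hb.measurable_dot σ)).aestronglyMeasurable, ?_⟩
  rw [hasFiniteIntegral_iff_ofReal (Eventually.of_forall fun z =>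
    mul_nonneg (one_sub_dot_sq_nonneg z σ) (hb.dot_nonneg z σ))]
  simpa only [dot_comm σ] using hl σ

/-- The value at `σ` of `𝓑 h`, symmetrized by the reflection through the line `ℝσ`: the integrand is
a second difference of `h`, and the integral converges absolutely. -/
noncomputable def symB (b : ℝ → ℝ) (h : E d → ℝ) (σ : S d) : ℝ :=
  ∫ z : S d, 1 / 2 * (h z + h (lineRefl (σ : E d) z) - 2 * h σ) * b (dot z σ) ∂(surf d)

lemma EvenHom.abs_secondDiff_le {h : E d → ℝ} (hh : EvenHom h) (σ : S d) :
    ∃ C : ℝ, ∀ z : S d, |h z + h (lineRefl (σ : E d) z) - 2 * h σ| ≤ C * (1 - dot z σ ^ 2) := by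
  obtain ⟨C, hC⟩ := exists_secondDiff_le (X := ℝ) (Ψ := fun _ => h) (x₀ := 0)
    (fun z hz => ((hh.contDiffAt z hz).of_le ENat.LEInfty.out).comp (0, z) contDiffAt_snd)
    (fun _ z c hc => hh.hom c z hc) σ
  exact ⟨C, fun z => by simpa using hC.self_of_nhds z⟩

lemma EvenHom.integrable_symB {h : E d → ℝ} (hh : EvenHom h) (hb : IsKernel b)
    (hl : LevyCondition d b) (σ : S d) :
    Integrable (fun z : S d => 1 / 2 * (h z + h (lineRefl (σ : E d) z) - 2 * h σ) * b (dot z σ))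
      (surf d) := by
  obtain ⟨C, hC⟩ := hh.abs_secondDiff_le σ
  have hmeas : Measurable fun z : S d => h z + h (lineRefl (σ : E d) z) - 2 * h σ :=
    ((hh.continuous_coe.add (hh.continuous_coe.comp (continuous_sphMap (lineRefl (σ : E d))))).sub
      continuous_const).measurable
  refine ((hl.integrable hb σ).const_mul (1 / 2 * C)).mono'
    ((hmeas.const_mul _).mul (hb.measurable_dot σ)).aestronglyMeasurable
    (Eventually.of_forall fun z => ?_)
  rw [norm_mul, norm_mul, Real.norm_of_nonneg (hb.dot_nonneg z σ), Real.norm_eq_abs,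
    Real.norm_eq_abs, abs_of_nonneg (by norm_num : (0 : ℝ) ≤ 1 / 2)]
  calc _ ≤ 1 / 2 * (C * (1 - dot z σ ^ 2)) * b (dot z σ) := by
        gcongr
        · exact hb.dot_nonneg z σ
        · exact hC z
    _ = _ := by ring

lemma truncB_eq {h : E d → ℝ} (hh : EvenHom h) (hb : IsKernel b)
    (hl : LevyCondition d b) (σ : S d) {ε : ℝ} (hε : ε ∈ Ioo (0 : ℝ) 1) :
    truncB b ε (fun τ : S d => h τ) σ = ∫ z in {z : S d | |dot z σ| < 1 - ε},
      1 / 2 * (h z + h (lineRefl (σ : E d) z) - 2 * h σ) * b (dot z σ) ∂(surf d) := by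
  set T : Set (S d) := {z : S d | |dot z σ| < 1 - ε} with hT
  have hTm : MeasurableSet T :=
    measurableSet_lt (continuous_dot_left σ).abs.measurable measurable_const
  set G : S d → ℝ := fun z => (h z - h σ) * b (dot z σ) with hG
  have hGi : IntegrableOn G T (surf d) := by
    obtain ⟨M, hM⟩ := (isCompact_univ (X := S d)).exists_bound_of_continuousOn
      (hh.continuous_coe.sub continuous_const : Continuous fun z : S d => h z - h σ).continuousOn
    set κ := 1 - (1 - ε) ^ 2 with hκ
    have hκ0 : 0 < κ := by
      rw [hκ]
      nlinarith [hε.1, hε.2]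
    refine ((hl.integrable hb σ).const_mul (M / κ)).integrableOn.mono'
      (((hh.continuous_coe.sub continuous_const).measurable.mul
        (hb.measurable_dot σ)).aestronglyMeasurable) ((ae_restrict_iff' hTm).2
        (Eventually.of_forall fun z hz => ?_))
    have hz' : κ ≤ 1 - dot z σ ^ 2 := by
      rw [hκ, ← sq_abs (dot z σ)]
      have : |dot z σ| < 1 - ε := hz
      nlinarith [abs_nonneg (dot z σ)]
    have hMz := hM z (mem_univ z)
    have hM0 : 0 ≤ M := (norm_nonneg _).trans hMz
    rw [hG, norm_mul, Real.norm_of_nonneg (hb.dot_nonneg z σ), ← mul_assoc]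
    refine mul_le_mul_of_nonneg_right (hMz.trans ?_) (hb.dot_nonneg z σ)
    rw [div_mul_eq_mul_div, le_div_iff₀ hκ0]
    exact mul_le_mul_of_nonneg_left hz' hM0
  set ρ := sphMap (lineRefl (σ : E d))
  have hpre : ρ ⁻¹' T = T := by
    ext z
    simp only [hT, mem_preimage, mem_ofPred_eq, ρ, dot_lineRefl]
  have hGρ : IntegrableOn (G ∘ ρ) T (surf d) := by
    have := ((measurePreserving_sphMap (lineRefl (σ : E d))).integrableOn_comp_preimage
      (measurableEmbedding_sphMap _) (f := G) (s := T)).2 hGi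
    rwa [hpre] at this
  have h1 : ∫ z in T, G (ρ z) ∂(surf d) = ∫ z in T, G z ∂(surf d) := by
    have := (measurePreserving_sphMap (lineRefl (σ : E d))).setIntegral_preimage_emb
      (measurableEmbedding_sphMap _) G T
    rwa [hpre] at this
  calc truncB b ε (fun τ : S d => h τ) σ = ∫ z in T, G z ∂(surf d) := rfl
    _ = 1 / 2 * (∫ z in T, G z ∂(surf d) + ∫ z in T, G (ρ z) ∂(surf d)) := by rw [h1]; ring
    _ = ∫ z in T, 1 / 2 * (G z + G (ρ z)) ∂(surf d) := by
        have h2 := integral_add hGi hGρ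
        simp only [Function.comp_apply] at h2
        rw [integral_const_mul, h2]
    _ = _ := by
        congr 1
        funext z
        simp only [hG, ρ, dot_lineRefl, coe_sphMap]
        ring

/-- The principal value converges, to the symmetrized integral. -/
lemma tendsto_truncB {h : E d → ℝ} (hh : EvenHom h) (hb : IsKernel b)
    (hl : LevyCondition d b) (σ : S d) :
    Tendsto (fun ε => truncB b ε (fun τ : S d => h τ) σ) (𝓝[>] (0 : ℝ)) (𝓝 (symB b h σ)) := by
  set D : S d → ℝ := fun z =>
    1 / 2 * (h z + h (lineRefl (σ : E d) z) - 2 * h σ) * b (dot z σ) with hD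
  have hTm : ∀ ε : ℝ, MeasurableSet {z : S d | |dot z σ| < 1 - ε} := fun ε =>
    measurableSet_lt (continuous_dot_left σ).abs.measurable measurable_const
  have hDi : Integrable D (surf d) := hh.integrable_symB hb hl σ
  have hev : (fun ε => truncB b ε (fun τ : S d => h τ) σ) =ᶠ[𝓝[>] (0 : ℝ)]
      fun ε => ∫ z, {z : S d | |dot z σ| < 1 - ε}.indicator D z ∂(surf d) := by
    filter_upwards [Ioo_mem_nhdsGT (zero_lt_one' ℝ)] with ε hε
    rw [truncB_eq hh hb hl σ hε, integral_indicator (hTm ε)]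
  rw [tendsto_congr' hev]
  refine tendsto_integral_filter_of_dominated_convergence (fun z => ‖D z‖)
    (Eventually.of_forall fun ε => hDi.aestronglyMeasurable.indicator (hTm ε))
    (Eventually.of_forall fun ε => Eventually.of_forall fun z => norm_indicator_le_norm_self _ _)
    hDi.norm (Eventually.of_forall fun z => ?_)
  rcases (abs_dot_le_one z σ).lt_or_eq with hlt | heq
  · refine tendsto_const_nhds.congr' ?_
    filter_upwards [Ioo_mem_nhdsGT (sub_pos.2 hlt)] with ε hε
    rw [indicator_of_mem]
    change |dot z σ| < 1 - ε
    linarith [hε.2]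
  · -- at `z = ±σ` the second difference vanishes
    have h0 : D z = 0 := by
      obtain ⟨C, hC⟩ := hh.abs_secondDiff_le σ
      have := hC z
      rw [← sq_abs (dot z σ), heq] at this
      have h2 : h z + h (lineRefl (σ : E d) z) - 2 * h σ = 0 := by
        apply abs_nonpos_iff.1
        simpa using this
      simp [hD, h2]
    have : ∀ ε : ℝ, {z : S d | |dot z σ| < 1 - ε}.indicator D z = 0 := fun ε => by
      by_cases hz : z ∈ {z : S d | |dot z σ| < 1 - ε}
      · rw [indicator_of_mem hz, h0]
      · rw [indicator_of_notMem hz]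
    simp only [this]
    change Tendsto _ _ (𝓝 (D z))
    rw [h0]
    exact tendsto_const_nhds

lemma opB_eq {h : E d → ℝ} (hh : EvenHom h) (hb : IsKernel b)
    (hl : LevyCondition d b) (σ : S d) : opB b (fun τ : S d => h τ) σ = symB b h σ :=
  (tendsto_truncB hh hb hl σ).limUnder_eq

/-- `𝓑` commutes with isometries: this gives the value of `𝓑 h` at every point `L σ` as an integral
against the kernel `b (z · σ)` centred at the fixed point `σ`. -/
lemma symB_sphMap (h : E d → ℝ) (L : E d ≃ₗᵢ[ℝ] E d) (σ : S d) :
    symB b h (sphMap L σ) =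
      ∫ z : S d, 1 / 2 * (h (L z) + h (L (lineRefl (σ : E d) z)) - 2 * h (L σ)) * b (dot z σ)
        ∂(surf d) := by
  rw [symB, ← (measurePreserving_sphMap L).integral_comp (measurableEmbedding_sphMap L)]
  simp only [coe_sphMap, lineRefl_map, dot_sphMap]

end

/-! ### Differentiation of the Boltzmann operator -/

section

variable {d : ℕ} {b : ℝ → ℝ} {h : E d → ℝ}

section Abstract

variable {V : Type*} [NormedAddCommGroup V] [InnerProductSpace ℝ V]

/-- The derivative of `A ↦ h (A z)`. -/
noncomputable def evalDeriv (h : V → ℝ) (A : V →L[ℝ] V) (z : V) : (V →L[ℝ] V) →L[ℝ] ℝ :=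
  (fderiv ℝ h (A z)).comp (ContinuousLinearMap.apply ℝ V z)

@[simp] lemma evalDeriv_apply (h : V → ℝ) (A B : V →L[ℝ] V) (z : V) :
    evalDeriv h A z B = fderiv ℝ h (A z) (B z) := rfl

lemma hasFDerivAt_eval {h : V → ℝ} {A : V →L[ℝ] V} {z : V} (hh : DifferentiableAt ℝ h (A z)) :
    HasFDerivAt (fun A : V →L[ℝ] V => h (A z)) (evalDeriv h A z) A :=
  hh.hasFDerivAt.comp A (ContinuousLinearMap.apply ℝ V z).hasFDerivAt

lemma contDiffAt_evalDeriv {h : V → ℝ} {A : V →L[ℝ] V} {z : V} (hh : ContDiffAt ℝ ∞ h (A z)) :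
    ContDiffAt ℝ 2 (fun p : (V →L[ℝ] V) × V => evalDeriv h p.1 p.2) (A, z) := by
  have h1 : ContDiffAt ℝ 2 (fun p : (V →L[ℝ] V) × V => p.1 p.2) (A, z) :=
    contDiffAt_fst.clm_apply contDiffAt_snd
  have h2 : ContDiffAt ℝ 2 (fderiv ℝ h) (A z) :=
    (hh.fderiv_right (m := ∞) (by simp)).of_le ENat.LEInfty.out
  have h3 : ContDiffAt ℝ 2 (fun p : (V →L[ℝ] V) × V =>
      ContinuousLinearMap.apply ℝ V p.2) (A, z) := by
    fun_prop
  exact (ContDiffAt.comp (A, z) (g := fderiv ℝ h)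
    (f := fun p : (V →L[ℝ] V) × V => p.1 p.2) h2 h1).clm_comp h3

lemma eventually_injective_near_one :
    ∀ᶠ A in 𝓝 (1 : V →L[ℝ] V), ∀ z : V, z ≠ 0 → A z ≠ 0 := by
  filter_upwards [Metric.ball_mem_nhds (1 : V →L[ℝ] V) zero_lt_one] with A hA z hz hAz
  have h1 : ‖(A - 1) z‖ ≤ ‖A - 1‖ * ‖z‖ := (A - 1).le_opNorm z
  rw [sub_apply, hAz, zero_sub, norm_neg, one_apply_eq_self] at h1
  rw [Metric.mem_ball, dist_eq_norm] at hA
  nlinarith [norm_pos_iff.2 hz]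

lemma differentiableAt_reflection {m : V → V} {x : V} (hm : DifferentiableAt ℝ m x)
    (hx : m x ≠ 0) :
    DifferentiableAt ℝ (fun x => (2 * (‖m x‖ ^ 2)⁻¹) • (innerSL ℝ (m x)).smulRight (m x)
      - ContinuousLinearMap.id ℝ V) x := by
  have h1 : DifferentiableAt ℝ (fun x => (‖m x‖ ^ 2)⁻¹) x :=
    (hm.norm_sq ℝ).inv (by simpa using hx)
  have h2 : ContDiff ℝ 1 fun v : V => (innerSL ℝ v).smulRight v :=
    ContDiff.smulRight (innerSL ℝ).contDiff contDiff_id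
  have h3 : DifferentiableAt ℝ (fun x => (innerSL ℝ (m x)).smulRight (m x)) x :=
    (h2.differentiable (by simp) (m x)).comp x hm
  exact ((h1.const_mul 2).smul h3).sub (differentiableAt_const _)

/-- Every skew-adjoint map is the velocity at the identity of a curve of isometries. -/
lemma exists_isometry_curve [CompleteSpace V] {A : V →L[ℝ] V}
    (hA : A ∈ skewAdjoint (V →L[ℝ] V)) :
    ∃ U : ℝ → V ≃ₗᵢ[ℝ] V, ((U 0 : V ≃ₗᵢ[ℝ] V) : V →L[ℝ] V) = 1 ∧
      HasDerivAt (fun t => (U t : V →L[ℝ] V)) A 0 := by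
  let _ : NormedAlgebra ℚ (V →L[ℝ] V) := NormedAlgebra.restrictScalars ℚ ℝ _
  have h0 : NormedSpace.exp ((0 : ℝ) • A) = 1 := by rw [zero_smul, NormedSpace.exp_zero]
  refine ⟨fun t => Unitary.linearIsometryEquiv
    ⟨NormedSpace.exp (t • A), NormedSpace.exp_mem_unitary_of_mem_skewAdjoint
      (skewAdjoint.smul_mem t hA)⟩, h0, ?_⟩
  have := hasDerivAt_exp_smul_const (𝕂 := ℝ) A 0
  rw [h0, one_mul] at this
  exact this

end Abstract

/-- Differentiation with respect to a parameter of integrals of second differences against `b`. -/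
lemma hasFDerivAt_integral_secondDiff {X : Type*} [NormedAddCommGroup X] [NormedSpace ℝ X]
    (hb : IsKernel b) (hl : LevyCondition d b) (σ : S d) {Φ : X → E d → ℝ}
    {Φ' : X → E d → X →L[ℝ] ℝ} {x₀ : X}
    (hdiff : ∀ᶠ x in 𝓝 x₀, ∀ z : E d, z ≠ 0 → HasFDerivAt (Φ · z) (Φ' x z) x)
    (hcont : ∀ᶠ x in 𝓝 x₀, Continuous fun z : S d => Φ x z)
    (hcont' : Continuous fun z : S d => Φ' x₀ z)
    (hint : Integrable (fun z : S d =>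
      1 / 2 * (Φ x₀ z + Φ x₀ (lineRefl (σ : E d) z) - 2 * Φ x₀ σ) * b (dot z σ)) (surf d))
    {C : ℝ} (hC : ∀ᶠ x in 𝓝 x₀, ∀ z : S d,
      ‖Φ' x z + Φ' x (lineRefl (σ : E d) z) - (2 : ℝ) • Φ' x σ‖ ≤ C * (1 - dot z σ ^ 2)) :
    ∃ T : X →L[ℝ] ℝ, HasFDerivAt (fun x => ∫ z : S d,
        1 / 2 * (Φ x z + Φ x (lineRefl (σ : E d) z) - 2 * Φ x σ) * b (dot z σ) ∂(surf d)) T x₀ ∧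
      ∀ y, T y = ∫ z : S d, 1 / 2 * (Φ' x₀ z y + Φ' x₀ (lineRefl (σ : E d) z) y - 2 * Φ' x₀ σ y)
        * b (dot z σ) ∂(surf d) := by
  let F' : X → S d → X →L[ℝ] ℝ := fun x z =>
    b (dot z σ) • ((1 / 2 : ℝ) • (Φ' x z + Φ' x (lineRefl (σ : E d) z) - (2 : ℝ) • Φ' x σ))
  have hF'm : AEStronglyMeasurable (F' x₀) (surf d) :=
    (hb.measurable_dot σ).aestronglyMeasurable.smul
      ((((hcont'.add (hcont'.comp (continuous_sphMap (lineRefl (σ : E d))))).sub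
        continuous_const).const_smul (1 / 2 : ℝ)).aestronglyMeasurable)
  have hF'b : ∀ x, (∀ z : S d, ‖Φ' x z + Φ' x (lineRefl (σ : E d) z) - (2 : ℝ) • Φ' x σ‖
      ≤ C * (1 - dot z σ ^ 2)) → ∀ z, ‖F' x z‖ ≤ C * ((1 - dot z σ ^ 2) * b (dot z σ)) := by
    intro x hx z
    rw [norm_smul, norm_smul, Real.norm_of_nonneg (hb.dot_nonneg z σ),
      Real.norm_of_nonneg (by norm_num : (0 : ℝ) ≤ 1 / 2)]
    calc b (dot z σ) * (1 / 2 * ‖_‖) ≤ b (dot z σ) * (C * (1 - dot z σ ^ 2)) := by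
          refine mul_le_mul_of_nonneg_left ?_ (hb.dot_nonneg z σ)
          have := hx z
          have h0 := norm_nonneg (Φ' x z + Φ' x (lineRefl (σ : E d) z) - (2 : ℝ) • Φ' x σ)
          linarith
      _ = _ := by ring
  have hmain := hasFDerivAt_integral_of_dominated_of_fderiv_le (𝕜 := ℝ) (μ := surf d)
    (F := fun (x : X) (z : S d) =>
      1 / 2 * (Φ x z + Φ x (lineRefl (σ : E d) z) - 2 * Φ x σ) * b (dot z σ))
    (F' := F') (x₀ := x₀) (bound := fun z => C * ((1 - dot z σ ^ 2) * b (dot z σ)))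
    (Filter.inter_mem hC hdiff) ?_ hint hF'm
    (Eventually.of_forall fun z x hx => hF'b x hx.1 z)
    ((hl.integrable hb σ).const_mul C)
    (Eventually.of_forall fun z x hx => ?_)
  · refine ⟨_, hmain, fun y => ?_⟩
    have hint : Integrable (F' x₀) (surf d) :=
      ((hl.integrable hb σ).const_mul C).mono' hF'm
        (Eventually.of_forall (hF'b x₀ hC.self_of_nhds))
    rw [ContinuousLinearMap.integral_apply hint]
    congr 1
    funext z
    simp only [F', smul_apply, add_apply,
      sub_apply, smul_eq_mul]
    ring
  · filter_upwards [hcont] with x hx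
    exact ((((hx.add (hx.comp (continuous_sphMap (lineRefl (σ : E d))))).sub
      continuous_const).measurable.const_mul _).mul (hb.measurable_dot σ)).aestronglyMeasurable
  · have hz := hx.2 z (coe_S_ne_zero z)
    have hz' := hx.2 (lineRefl (σ : E d) z) (by simpa using coe_S_ne_zero z)
    have hs := hx.2 σ (coe_S_ne_zero σ)
    exact ((((hz.add hz').sub (hs.const_mul 2)).const_mul (1 / 2)).mul_const (b (dot z σ)))

/-- The integral `∫ (h (A σ') - h (A σ)) b (σ' · σ) dσ'`, symmetrized, as a function of a linear map
`A`. If `A` is an isometry it is `𝓑 h (A σ)`. -/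
noncomputable def transportedB (b : ℝ → ℝ) (h : E d → ℝ) (σ : S d) (A : E d →L[ℝ] E d) : ℝ :=
  ∫ z : S d, 1 / 2 * (h (A z) + h (A (lineRefl (σ : E d) z)) - 2 * h (A σ)) * b (dot z σ)
    ∂(surf d)

/-- The derivative of `transportedB` at the identity, in the direction of `B`, is `𝓑` applied to the
derivative of `h` along the linear vector field `B`. -/
lemma EvenHom.hasFDerivAt_transportedB (hh : EvenHom h) (hb : IsKernel b) (hl : LevyCondition d b)
    (σ : S d) :
    ∃ T : (E d →L[ℝ] E d) →L[ℝ] ℝ, HasFDerivAt (transportedB b h σ) T 1 ∧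
      ∀ B, T B = symB b (fun x => fderiv ℝ h x (B x)) σ := by
  obtain ⟨C, hC⟩ := exists_secondDiff_le (Ψ := evalDeriv h) (x₀ := (1 : E d →L[ℝ] E d))
    (fun z hz => contDiffAt_evalDeriv (hh.contDiffAt _ (by simpa using hz)))
    (fun A z c hc => by ext B; simp [hh.fderiv_smul hc, hc]) σ
  refine hasFDerivAt_integral_secondDiff hb hl σ (Φ := fun A z => h (A z)) (Φ' := evalDeriv h)
    (x₀ := (1 : E d →L[ℝ] E d)) ?_ ?_ ?_ (hh.integrable_symB hb hl σ) hC
  · filter_upwards [eventually_injective_near_one] with A hA z hz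
    exact hasFDerivAt_eval (hh.differentiableAt (hA z hz))
  · filter_upwards [eventually_injective_near_one] with A hA
    exact continuous_iff_continuousAt.2 fun z =>
      ContinuousAt.comp (g := h) (f := fun z : S d => A z)
        (hh.contDiffAt _ (hA z (coe_S_ne_zero z))).continuousAt
        (A.continuous.comp continuous_subtype_val).continuousAt
  · refine continuous_iff_continuousAt.2 fun z => ?_
    have h1 := (contDiffAt_evalDeriv (A := 1) (z := (z : E d))
      (hh.contDiffAt _ (coe_S_ne_zero z))).continuousAt
    exact ContinuousAt.comp (g := fun p : (E d →L[ℝ] E d) × E d => evalDeriv h p.1 p.2)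
      (f := fun z : S d => ((1 : E d →L[ℝ] E d), (z : E d))) h1
      (continuous_const.prodMk continuous_subtype_val).continuousAt

lemma homExt_opB_eq (hh : EvenHom h) (hb : IsKernel b) (hl : LevyCondition d b) (σ : S d)
    (L : E d ≃ₗᵢ[ℝ] E d) :
    opB b (fun τ : S d => h τ) (sphMap L σ) = transportedB b h σ (L : E d →L[ℝ] E d) := by
  rw [opB_eq hh hb hl, symB_sphMap]
  rfl

/-- The extension of `𝓑 h` is differentiable: for `x` near `σ` it equals `transportedB` at an
isometry which depends smoothly on `x` and maps `σ` to `x / ‖x‖`. -/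
lemma differentiableAt_opB (hh : EvenHom h) (hb : IsKernel b) (hl : LevyCondition d b) (σ : S d) :
    DifferentiableAt ℝ (homExt (opB b fun τ : S d => h τ)) (σ : E d) := by
  obtain ⟨T, hT, -⟩ := hh.hasFDerivAt_transportedB hb hl σ
  let m : E d → E d := fun x => (σ : E d) + ‖x‖⁻¹ • x
  -- the composition of the reflections through the lines spanned by `σ` and `m x`
  let L : E d → (E d ≃ₗᵢ[ℝ] E d) := fun x => (lineRefl (σ : E d)).trans (lineRefl (m x))
  let G : E d → (E d →L[ℝ] E d) := fun x =>
    ((2 * (‖m x‖ ^ 2)⁻¹) • (innerSL ℝ (m x)).smulRight (m x) - ContinuousLinearMap.id ℝ (E d)).comp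
      ((lineRefl (σ : E d) : E d ≃ₗᵢ[ℝ] E d) : E d →L[ℝ] E d)
  have hLG : ∀ x, (L x : E d →L[ℝ] E d) = G x := by
    intro x
    ext1 z
    simp [L, G, lineRefl_apply (m x), smul_smul, div_eq_mul_inv, mul_assoc, mul_comm]
  have hmσ : m σ = (2 : ℝ) • (σ : E d) := by simp [m, two_smul]
  have hGσ : G σ = 1 := by
    rw [← hLG]
    ext1 z
    have : lineRefl (m σ) (lineRefl (σ : E d) z) = z := by
      have h1 : ∀ y, lineRefl (m σ) y = lineRefl (σ : E d) y := fun y => by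
        rw [lineRefl_apply, lineRefl_apply, hmσ, norm_smul, inner_smul_left, smul_smul]
        norm_num
        congr 1
        ring
      rw [h1, lineRefl_lineRefl]
    exact this
  have hmd : DifferentiableAt ℝ m σ := by
    have h1 : DifferentiableAt ℝ (fun x : E d => ‖x‖) (σ : E d) :=
      (contDiffAt_norm ℝ (coe_S_ne_zero σ) (n := 1)).differentiableAt (by simp)
    exact (differentiableAt_const _).add
      ((h1.inv (by simp)).smul differentiableAt_id)
  have hGd : DifferentiableAt ℝ G σ :=
    (differentiableAt_reflection hmd
      (by rw [hmσ]; exact smul_ne_zero two_ne_zero (coe_S_ne_zero σ))).clm_comp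
      (differentiableAt_const _)
  have hev : homExt (opB b fun τ : S d => h τ) =ᶠ[𝓝 (σ : E d)] fun x => transportedB b h σ (G x) := by
    have e1 : ∀ᶠ x in 𝓝 (σ : E d), x ≠ 0 := isOpen_ne.mem_nhds (coe_S_ne_zero σ)
    have e2 : ∀ᶠ x in 𝓝 (σ : E d), m x ≠ 0 :=
      hmd.continuousAt.eventually_ne (by rw [hmσ]; exact smul_ne_zero two_ne_zero (coe_S_ne_zero σ))
    filter_upwards [e1, e2] with x hx hmx
    rw [homExt_of_ne hx, ← hLG, ← homExt_opB_eq hh hb hl]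
    congr 1
    apply Subtype.ext
    change ‖x‖⁻¹ • x = lineRefl (m x) (lineRefl (σ : E d) σ)
    set y := ‖x‖⁻¹ • x with hy
    have hy1 : ‖y‖ = 1 := by simp [hy, norm_smul, hx]
    have h3 : ‖m x‖ ^ 2 = 2 * inner ℝ (m x) (σ : E d) := by
      change ‖(σ : E d) + y‖ ^ 2 = 2 * inner ℝ ((σ : E d) + y) (σ : E d)
      rw [norm_add_sq_real, inner_add_left, real_inner_self_eq_norm_sq, norm_coe_S, hy1,
        real_inner_comm]
      ring
    have h4 : ‖m x‖ ^ 2 ≠ 0 := by simpa using hmx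
    rw [lineRefl_self, lineRefl_apply, ← mul_div_assoc, ← h3, div_self h4, one_smul]
    simp [m, hy]
  refine DifferentiableAt.congr_of_eventuallyEq ?_ hev
  rw [← hGσ] at hT
  exact hT.differentiableAt.comp (σ : E d) hGd

lemma continuous_opB (hh : EvenHom h) (hb : IsKernel b) (hl : LevyCondition d b) :
    Continuous (opB b fun τ : S d => h τ) := by
  have h1 : opB b (fun τ : S d => h τ) = fun σ : S d => homExt (opB b fun τ : S d => h τ) σ :=
    funext fun σ => (homExt_coe _ σ).symm
  rw [h1]
  exact continuous_iff_continuousAt.2 fun σ =>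
    ContinuousAt.comp (g := homExt (opB b fun τ : S d => h τ)) (f := Subtype.val)
      (differentiableAt_opB hh hb hl σ).continuousAt continuous_subtype_val.continuousAt

/-- `𝓑` commutes with the infinitesimal rotations `h ↦ Dh (A x)`, for `A` skew-adjoint. -/
lemma fderiv_opB_skew (hh : EvenHom h) (hb : IsKernel b) (hl : LevyCondition d b) (σ : S d)
    {A : E d →L[ℝ] E d} (hA : A ∈ skewAdjoint (E d →L[ℝ] E d)) :
    fderiv ℝ (homExt (opB b fun τ : S d => h τ)) (σ : E d) (A σ) =
      symB b (fun x => fderiv ℝ h x (A x)) σ := by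
  obtain ⟨T, hT, hTB⟩ := hh.hasFDerivAt_transportedB hb hl σ
  rw [← hTB]
  obtain ⟨U, hU0, hU⟩ := exists_isometry_curve hA
  have h1 : HasDerivAt (fun t : ℝ => transportedB b h σ (U t)) (T A) 0 := by
    rw [← hU0] at hT
    exact hT.comp_hasDerivAt 0 hU
  have h2 : HasDerivAt (fun t : ℝ => homExt (opB b fun τ : S d => h τ)
      ((U t : E d →L[ℝ] E d) (σ : E d)))
      (fderiv ℝ (homExt (opB b fun τ : S d => h τ)) (σ : E d) (A σ)) 0 := by
    have h3 : HasDerivAt (fun t : ℝ => (U t : E d →L[ℝ] E d) (σ : E d)) (A σ) 0 := by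
      simpa using hU.clm_apply (hasDerivAt_const (0 : ℝ) (σ : E d))
    have h4 := (differentiableAt_opB hh hb hl σ).hasFDerivAt
    have h5 : (U 0 : E d →L[ℝ] E d) (σ : E d) = σ := by rw [hU0]; rfl
    rw [← h5] at h4
    have h6 := h4.comp_hasDerivAt 0 h3
    rwa [h5] at h6
  have h7 : (fun t : ℝ => homExt (opB b fun τ : S d => h τ) ((U t : E d →L[ℝ] E d) (σ : E d)))
      = fun t : ℝ => transportedB b h σ (U t) := by
    funext t
    have := homExt_opB_eq hh hb hl σ (U t)
    rw [← homExt_coe (opB b fun τ : S d => h τ)] at this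
    exact this
  rw [h7] at h2
  exact h2.unique h1

end

/-! ### The iterated carré du champ as a sum of squares -/

section

variable {d : ℕ} {b : ℝ → ℝ} {h : E d → ℝ}

/-- The generator `x ↦ x_i e_j - x_j e_i` of the rotations in the coordinate plane `(i, j)`. -/
noncomputable def rotGen (i j : Fin d) : E d →L[ℝ] E d :=
  (EuclideanSpace.proj i : E d →L[ℝ] ℝ).smulRight (EuclideanSpace.single j 1) -
    (EuclideanSpace.proj j : E d →L[ℝ] ℝ).smulRight (EuclideanSpace.single i 1)

lemma rotGen_apply (i j : Fin d) (x : E d) :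
    rotGen i j x = x i • EuclideanSpace.single j 1 - x j • EuclideanSpace.single i 1 := rfl

lemma rotGen_mem_skewAdjoint (i j : Fin d) : rotGen i j ∈ skewAdjoint (E d →L[ℝ] E d) := by
  rw [skewAdjoint.mem_iff, ContinuousLinearMap.star_eq_adjoint, eq_comm,
    ContinuousLinearMap.eq_adjoint_iff]
  intro x y
  rw [neg_apply, rotGen_apply, rotGen_apply]
  simp [inner_sub_left, inner_sub_right, inner_smul_left, inner_smul_right,
    EuclideanSpace.inner_single_left, EuclideanSpace.inner_single_right]
  ring

/-- The derivative `x_i ∂_j h - x_j ∂_i h` of `h` along an infinitesimal rotation. -/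
noncomputable def rotDeriv (h : E d → ℝ) (i j : Fin d) (x : E d) : ℝ := fderiv ℝ h x (rotGen i j x)

lemma EvenHom.rotDeriv (hh : EvenHom h) (i j : Fin d) : EvenHom (rotDeriv h i j) :=
  hh.fderiv_apply (rotGen i j)

/-- Half the sum of the squares of the increments of the rotational derivatives of `h`. -/
noncomputable def rotEnergy (h : E d → ℝ) (x y : E d) : ℝ :=
  1 / 2 * ∑ i, ∑ j, (rotDeriv h i j y - rotDeriv h i j x) ^ 2

lemma rotEnergy_nonneg (h : E d → ℝ) (x y : E d) : 0 ≤ rotEnergy h x y := by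
  unfold rotEnergy
  positivity

/-- Lagrange's identity (Cauchy–Binet) for `2 × 2` minors. -/
lemma sum_minors (x p y q : E d) :
    ∑ i, ∑ j, (x i * p j - x j * p i) * (y i * q j - y j * q i) =
      2 * (inner ℝ x y * inner ℝ p q - inner ℝ x q * inner ℝ p y) := by
  have h1 : ∀ u v : E d, inner ℝ u v = ∑ i, u i * v i := fun u v => by
    simp [PiLp.inner_apply, mul_comm]
  have h2 : ∀ a c : Fin d → ℝ, ∑ i, ∑ j, a i * c j = (∑ i, a i) * ∑ j, c j := fun a c =>
    (Finset.sum_mul_sum _ _ _ _).symm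
  have h3 : ∀ i j, (x i * p j - x j * p i) * (y i * q j - y j * q i) =
      (x i * y i) * (p j * q j) + (p i * q i) * (x j * y j) - (x i * q i) * (p j * y j)
        - (p i * y i) * (x j * q j) := fun i j => by ring
  simp only [h3, Finset.sum_add_distrib, Finset.sum_sub_distrib, h2, h1]
  ring

lemma sphGrad_inner_rotGen (g : S d → ℝ) (σ : S d) (i j : Fin d) :
    inner ℝ (sphGrad g σ) (rotGen i j (σ : E d)) =
      (σ : E d) i * sphGrad g σ j - (σ : E d) j * sphGrad g σ i := by
  rw [rotGen_apply]
  simp [inner_sub_right, inner_smul_right, EuclideanSpace.inner_single_right]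

lemma rotDeriv_coe (hh : EvenHom h) (σ : S d) (i j : Fin d) :
    rotDeriv h i j σ = (σ : E d) i * sphGrad (fun τ : S d => h τ) σ j
      - (σ : E d) j * sphGrad (fun τ : S d => h τ) σ i := by
  rw [rotDeriv, ← hh.inner_sphGrad, sphGrad_inner_rotGen]

lemma inner_coe_sphGrad (hh : EvenHom h) (σ : S d) :
    inner ℝ (σ : E d) (sphGrad (fun τ : S d => h τ) σ) = 0 := by
  rw [real_inner_comm, hh.inner_sphGrad, hh.fderiv_self (coe_S_ne_zero σ)]

/-- The carré du champ as a sum over infinitesimal rotations. -/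
lemma gammaΔ_eq_sum (g : S d → ℝ) (hh : EvenHom h) (σ : S d) :
    gammaΔ g (fun τ : S d => h τ) σ =
      1 / 2 * ∑ i, ∑ j, inner ℝ (sphGrad g σ) (rotGen i j (σ : E d)) * rotDeriv h i j σ := by
  simp only [sphGrad_inner_rotGen, rotDeriv_coe hh]
  rw [sum_minors, inner_coe_sphGrad hh, real_inner_self_eq_norm_sq, norm_coe_S, gammaΔ]
  ring

lemma gammaΔ_comm (f g : S d → ℝ) (σ : S d) : gammaΔ f g σ = gammaΔ g f σ := real_inner_comm _ _

/-- The square `Γ_Δ (h, h)`, extended to `ℝ^d`. -/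
noncomputable def sqField (h : E d → ℝ) (x : E d) : ℝ :=
  ∑ i, ∑ j, 1 / 2 * (rotDeriv h i j x * rotDeriv h i j x)

lemma EvenHom.sqField (hh : EvenHom h) : EvenHom (sqField h) :=
  EvenHom.sum fun i => EvenHom.sum fun j =>
    (EvenHom.const (1 / 2)).mul ((hh.rotDeriv i j).mul (hh.rotDeriv i j))

lemma gammaΔ_self (hh : EvenHom h) :
    gammaΔ (fun τ : S d => h τ) (fun τ : S d => h τ) = fun σ : S d => sqField h σ := by
  funext σ
  rw [gammaΔ_eq_sum _ hh, sqField]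
  simp only [Finset.mul_sum, hh.inner_sphGrad]
  rfl

lemma gammaSq_eq (hh : EvenHom h) (hb : IsKernel b) (hl : LevyCondition d b) (σ : S d) :
    gammaSq b (fun τ : S d => h τ) (fun τ : S d => h τ) σ =
      1 / 2 * (symB b (sqField h) σ - ∑ i, ∑ j, symB b (rotDeriv h i j) σ * rotDeriv h i j σ) := by
  have h1 : gammaΔ (opB b fun τ : S d => h τ) (fun τ : S d => h τ) σ =
      1 / 2 * ∑ i, ∑ j, symB b (rotDeriv h i j) σ * rotDeriv h i j σ := by
    rw [gammaΔ_eq_sum _ hh]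
    congr 1
    refine Finset.sum_congr rfl fun i _ => Finset.sum_congr rfl fun j _ => ?_
    congr 1
    rw [sphGrad, gradient, InnerProductSpace.toDual_symm_apply,
      fderiv_opB_skew hh hb hl σ (rotGen_mem_skewAdjoint i j)]
    rfl
  rw [gammaSq, gammaΔ_comm (fun τ : S d => h τ) (opB b fun τ : S d => h τ), gammaΔ_self hh,
    opB_eq hh.sqField hb hl, h1]
  ring

lemma continuous_gammaSq (hh : EvenHom h) (hb : IsKernel b) (hl : LevyCondition d b) :
    Continuous (gammaSq b (fun τ : S d => h τ) (fun τ : S d => h τ)) := by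
  have h1 : ∀ {k : E d → ℝ}, EvenHom k → Continuous (symB b k) := fun {k} hk => by
    have : symB b k = opB b fun τ : S d => k τ := funext fun σ => (opB_eq hk hb hl σ).symm
    rw [this]
    exact continuous_opB hk hb hl
  have h2 : gammaSq b (fun τ : S d => h τ) (fun τ : S d => h τ) = fun σ =>
      1 / 2 * (symB b (sqField h) σ - ∑ i, ∑ j, symB b (rotDeriv h i j) σ * rotDeriv h i j σ) :=
    funext fun σ => gammaSq_eq hh hb hl σ
  rw [h2]
  exact continuous_const.mul ((h1 hh.sqField).sub (continuous_finsetSum _ fun i _ =>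
    continuous_finsetSum _ fun j _ => (h1 (hh.rotDeriv i j)).mul (hh.rotDeriv i j).continuous_coe))

lemma continuous_rotEnergy (hh : EvenHom h) :
    Continuous fun p : S d × S d => rotEnergy h p.1 p.2 := by
  refine continuous_const.mul (continuous_finsetSum _ fun i _ => continuous_finsetSum _ fun j _ => ?_)
  exact (((hh.rotDeriv i j).continuous_coe.comp continuous_snd).sub
    ((hh.rotDeriv i j).continuous_coe.comp continuous_fst)).pow 2

/-- `Γ²` as the integral of a nonnegative integrand, symmetrized. -/
lemma gammaSq_eq_integral (hh : EvenHom h) (hb : IsKernel b) (hl : LevyCondition d b) (σ : S d) :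
    Integrable (fun z : S d => 1 / 4 * ((rotEnergy h σ z +
      rotEnergy h σ (lineRefl (σ : E d) z)) * b (dot z σ))) (surf d) ∧
    gammaSq b (fun τ : S d => h τ) (fun τ : S d => h τ) σ =
      ∫ z : S d, 1 / 4 * ((rotEnergy h σ z +
        rotEnergy h σ (lineRefl (σ : E d) z)) * b (dot z σ)) ∂(surf d) := by
  have hi1 := hh.sqField.integrable_symB hb hl σ
  have hi2 := fun i j => ((hh.rotDeriv i j).integrable_symB hb hl σ).mul_const (rotDeriv h i j σ)
  have hi3 : Integrable (fun z : S d => ∑ i, ∑ j,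
      1 / 2 * (rotDeriv h i j z + rotDeriv h i j (lineRefl (σ : E d) z) - 2 * rotDeriv h i j σ)
        * b (dot z σ) * rotDeriv h i j σ) (surf d) :=
    integrable_finsetSum _ fun i _ => integrable_finsetSum _ fun j _ => hi2 i j
  have hpt : ∀ z : S d, 1 / 4 * ((rotEnergy h σ z +
        rotEnergy h σ (lineRefl (σ : E d) z)) * b (dot z σ)) =
      1 / 2 * (1 / 2 * (sqField h z + sqField h (lineRefl (σ : E d) z) - 2 * sqField h σ)
          * b (dot z σ) - ∑ i, ∑ j,
        1 / 2 * (rotDeriv h i j z + rotDeriv h i j (lineRefl (σ : E d) z) - 2 * rotDeriv h i j σ)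
          * b (dot z σ) * rotDeriv h i j σ) := by
    intro z
    simp only [rotEnergy, sqField, Finset.mul_sum, Finset.sum_mul, ← Finset.sum_add_distrib,
      ← Finset.sum_sub_distrib]
    refine Finset.sum_congr rfl fun i _ => Finset.sum_congr rfl fun j _ => ?_
    ring
  have hI := (hi1.sub hi3).const_mul (1 / 2)
  refine ⟨(integrable_congr (Eventually.of_forall hpt)).2 hI, ?_⟩
  rw [gammaSq_eq hh hb hl, integral_congr_ae (Eventually.of_forall hpt), integral_const_mul,
    integral_sub hi1 hi3, integral_finsetSum _ fun i _ => integrable_finsetSum _ fun j _ => hi2 i j]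
  congr 2
  refine Finset.sum_congr rfl fun i _ => ?_
  rw [integral_finsetSum _ fun j _ => hi2 i j]
  refine Finset.sum_congr rfl fun j _ => ?_
  rw [integral_mul_const]
  rfl

lemma gammaSq_nonneg (hh : EvenHom h) (hb : IsKernel b) (hl : LevyCondition d b) (σ : S d) :
    0 ≤ gammaSq b (fun τ : S d => h τ) (fun τ : S d => h τ) σ := by
  rw [(gammaSq_eq_integral hh hb hl σ).2]
  refine integral_nonneg fun z => ?_
  have := rotEnergy_nonneg h σ z
  have := rotEnergy_nonneg h σ (lineRefl (σ : E d) z)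
  have := hb.dot_nonneg z σ
  positivity

lemma ofReal_gammaSq (hh : EvenHom h) (hb : IsKernel b) (hl : LevyCondition d b) (σ : S d) :
    ENNReal.ofReal (gammaSq b (fun τ : S d => h τ) (fun τ : S d => h τ) σ) =
      ∫⁻ z : S d, ENNReal.ofReal (1 / 2 * rotEnergy h σ z * b (dot z σ)) ∂(surf d) := by
  obtain ⟨hi, he⟩ := gammaSq_eq_integral hh hb hl σ
  have hQ := rotEnergy_nonneg h (σ : E d)
  have hB := fun z => hb.dot_nonneg z σ
  rw [he, ofReal_integral_eq_lintegral_ofReal hi (Eventually.of_forall fun z => by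
    have := hQ z
    have := hQ (lineRefl (σ : E d) z)
    have := hB z
    positivity)]
  set G : S d → ℝ≥0∞ := fun z => ENNReal.ofReal (1 / 4 * rotEnergy h σ z * b (dot z σ)) with hG
  have hGm : Measurable G :=
    (((continuous_rotEnergy hh).comp (continuous_const.prodMk continuous_id)).measurable.const_mul
      (1 / 4) |>.mul (hb.measurable_dot σ)).ennreal_ofReal
  set ρ := sphMap (lineRefl (σ : E d)) with hρ
  have h1 : ∫⁻ z, G (ρ z) ∂(surf d) = ∫⁻ z, G z ∂(surf d) :=
    (measurePreserving_sphMap _).lintegral_comp hGm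
  calc _ = ∫⁻ z, (G z + G (ρ z)) ∂(surf d) := by
        refine lintegral_congr fun z => ?_
        have := hQ z
        have := hQ (lineRefl (σ : E d) z)
        have := hB z
        simp only [hG, hρ, dot_lineRefl, coe_sphMap]
        rw [← ENNReal.ofReal_add (by positivity) (by positivity)]
        congr 1
        ring
    _ = ∫⁻ z, (G z + G z) ∂(surf d) := by
        rw [lintegral_add_left hGm, h1, lintegral_add_left hGm]
    _ = _ := by
        refine lintegral_congr fun z => ?_
        have := hQ z
        have := hB z
        rw [← ENNReal.ofReal_add (by positivity) (by positivity)]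
        congr 1
        ring

end

/-! ### An inequality on the circle -/

section

/-- Wirtinger's inequality with Dirichlet conditions, with a constant `l ^ 2 < 1`. -/
lemma sq_mul_integral_sq_le {φ φ' : ℝ → ℝ} (hφ : ∀ t, HasDerivAt φ (φ' t) t) (hφ' : Continuous φ')
    {a : ℝ} (h0 : φ a = 0) (hπ : φ (a + Real.pi) = 0) {l : ℝ} (hl : l ∈ Ioo (0 : ℝ) 1) :
    l ^ 2 * ∫ t in a..a + Real.pi, φ t ^ 2 ≤ ∫ t in a..a + Real.pi, φ' t ^ 2 := by
  have hcφ : Continuous φ := continuous_iff_continuousAt.2 fun t => (hφ t).continuousAt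
  have hpi := Real.pi_pos
  -- `q` is the logarithmic derivative of the positive function `sin θ`
  let θ : ℝ → ℝ := fun t => l * (t - a) + Real.pi * (1 - l) / 2
  let q : ℝ → ℝ := fun t => l * (Real.cos (θ t) / Real.sin (θ t))
  have hθ : ∀ t, HasDerivAt θ l t := fun t =>
    ((((hasDerivAt_id t).sub_const a).const_mul l).add_const
      (Real.pi * (1 - l) / 2)).congr_deriv (mul_one l)
  have hsin : ∀ t ∈ Icc a (a + Real.pi), 0 < Real.sin (θ t) := by
    intro t ht
    apply Real.sin_pos_of_pos_of_lt_pi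
    · have h1 : 0 ≤ l * (t - a) := mul_nonneg hl.1.le (by linarith [ht.1])
      have h2 : 0 < Real.pi * (1 - l) := mul_pos hpi (by linarith [hl.2])
      simp only [θ]
      linarith
    · have h1 : l * (t - a) ≤ l * Real.pi := mul_le_mul_of_nonneg_left (by linarith [ht.2]) hl.1.le
      have h2 : 0 < Real.pi * (1 - l) := mul_pos hpi (by linarith [hl.2])
      simp only [θ]
      linarith
  have hq : ∀ t ∈ Icc a (a + Real.pi), HasDerivAt q (-l ^ 2 - q t ^ 2) t := by
    intro t ht
    have hs := (hsin t ht).ne'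
    have h1 := ((((Real.hasDerivAt_cos (θ t)).comp t (hθ t)).div
      ((Real.hasDerivAt_sin (θ t)).comp t (hθ t)) hs).const_mul l)
    refine h1.congr_deriv ?_
    simp only [q, Function.comp_apply]
    field_simp
  have hqc : ContinuousOn q (Icc a (a + Real.pi)) := fun t ht =>
    (hq t ht).continuousAt.continuousWithinAt
  have hle : a ≤ a + Real.pi := by linarith
  have hD : ∀ t ∈ Icc a (a + Real.pi), HasDerivAt (fun t => φ t ^ 2 * q t)
      (2 * φ t * φ' t * q t + φ t ^ 2 * (-l ^ 2 - q t ^ 2)) t := by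
    intro t ht
    refine (((hφ t).pow 2).mul (hq t ht)).congr_deriv ?_
    simp
  have hDc : ContinuousOn (fun t => 2 * φ t * φ' t * q t + φ t ^ 2 * (-l ^ 2 - q t ^ 2))
      (uIcc a (a + Real.pi)) := by
    rw [uIcc_of_le hle]
    fun_prop
  have hint : ∫ t in a..a + Real.pi, (2 * φ t * φ' t * q t + φ t ^ 2 * (-l ^ 2 - q t ^ 2)) = 0 := by
    rw [intervalIntegral.integral_eq_sub_of_hasDerivAt
      (fun t ht => hD t (by rwa [uIcc_of_le hle] at ht)) hDc.intervalIntegrable]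
    simp [h0, hπ]
  have hI1 : IntervalIntegrable (fun t => l ^ 2 * φ t ^ 2) volume a (a + Real.pi) :=
    (by fun_prop : Continuous fun t => l ^ 2 * φ t ^ 2).intervalIntegrable _ _
  have hI2 : IntervalIntegrable (fun t => φ' t ^ 2) volume a (a + Real.pi) :=
    (hφ'.pow 2).intervalIntegrable _ _
  calc l ^ 2 * ∫ t in a..a + Real.pi, φ t ^ 2
      = (∫ t in a..a + Real.pi, l ^ 2 * φ t ^ 2) +
        ∫ t in a..a + Real.pi, (2 * φ t * φ' t * q t + φ t ^ 2 * (-l ^ 2 - q t ^ 2)) := by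
        rw [hint, add_zero, intervalIntegral.integral_const_mul]
    _ = ∫ t in a..a + Real.pi,
        (l ^ 2 * φ t ^ 2 + (2 * φ t * φ' t * q t + φ t ^ 2 * (-l ^ 2 - q t ^ 2))) :=
        (intervalIntegral.integral_add hI1 hDc.intervalIntegrable).symm
    _ ≤ ∫ t in a..a + Real.pi, φ' t ^ 2 := by
        refine intervalIntegral.integral_mono_on hle (hI1.add hDc.intervalIntegrable) hI2
          fun t _ => ?_
        nlinarith [sq_nonneg (φ' t - φ t * q t)]

/-- Wirtinger's inequality for functions with `φ (t + π) = - φ t`. -/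
lemma integral_sq_le_of_antiperiodic {φ φ' : ℝ → ℝ} (hφ : ∀ t, HasDerivAt φ (φ' t) t)
    (hφ' : Continuous φ') (hanti : ∀ t, φ (t + Real.pi) = -φ t) :
    ∫ t in (0 : ℝ)..Real.pi, φ t ^ 2 ≤ ∫ t in (0 : ℝ)..Real.pi, φ' t ^ 2 := by
  have hcφ : Continuous φ := continuous_iff_continuousAt.2 fun t => (hφ t).continuousAt
  have hanti' : ∀ t, φ' (t + Real.pi) = -φ' t := fun t => by
    have h1 : HasDerivAt (fun t => φ (t + Real.pi)) (φ' (t + Real.pi)) t :=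
      (hφ (t + Real.pi)).comp_add_const t Real.pi
    rw [funext hanti] at h1
    exact h1.unique (hφ t).neg
  obtain ⟨a, ha⟩ : ∃ a, φ a = 0 := by
    have h1 : φ Real.pi = -φ 0 := by simpa using hanti 0
    have h2 : (0 : ℝ) ∈ uIcc (φ 0) (φ Real.pi) := by
      rw [h1, mem_uIcc]
      rcases le_total (φ 0) 0 with h | h
      · exact Or.inl ⟨h, by linarith⟩
      · exact Or.inr ⟨by linarith, h⟩
    obtain ⟨a, -, ha⟩ := intermediate_value_uIcc hcφ.continuousOn h2
    exact ⟨a, ha⟩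
  have hp : Function.Periodic (fun t => φ t ^ 2) Real.pi := fun t => by simp [hanti]
  have hp' : Function.Periodic (fun t => φ' t ^ 2) Real.pi := fun t => by simp [hanti']
  have e1 := hp.intervalIntegral_add_eq 0 a
  have e2 := hp'.intervalIntegral_add_eq 0 a
  rw [zero_add] at e1 e2
  rw [e1, e2]
  have hlim : Tendsto (fun l : ℝ => l ^ 2 * ∫ t in a..a + Real.pi, φ t ^ 2) (𝓝[<] 1)
      (𝓝 (∫ t in a..a + Real.pi, φ t ^ 2)) := by
    have : Tendsto (fun l : ℝ => l ^ 2 * ∫ t in a..a + Real.pi, φ t ^ 2) (𝓝 1)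
        (𝓝 (1 ^ 2 * ∫ t in a..a + Real.pi, φ t ^ 2)) :=
      (Continuous.tendsto (by fun_prop) 1)
    rw [one_pow, one_mul] at this
    exact this.mono_left nhdsWithin_le_nhds
  refine le_of_tendsto hlim ?_
  filter_upwards [Ioo_mem_nhdsLT (zero_lt_one' ℝ)] with l hl
  exact sq_mul_integral_sq_le hφ hφ' ha (by rw [hanti, ha, neg_zero]) hl

/-- Pointwise, with `x = F (t)`, `y = F (t + π)` and `p`, `q` their derivatives: twice the square of
the derivative of `(x - y) / √(x + y)` is at most `(x + y) ((p / x)² + (q / y)²)`. -/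
lemma two_mul_sq_deriv_le {x y p q : ℝ} (hx : 0 < x) (hy : 0 < y) :
    2 * (((p - q) * √(x + y) - (x - y) * ((p + q) / (2 * √(x + y)))) / √(x + y) ^ 2) ^ 2 ≤
      (x + y) * ((p / x) ^ 2 + (q / y) ^ 2) := by
  have hs : 0 < x + y := add_pos hx hy
  set r := √(x + y) with hr
  have hr0 : 0 < r := Real.sqrt_pos.2 hs
  have hr2 : r ^ 2 = x + y := Real.sq_sqrt hs.le
  set A := p / x with hA
  set B := q / y with hB
  have hp : p = A * x := by rw [hA]; field_simp
  have hq : q = B * y := by rw [hB]; field_simp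
  have e1 : ((p - q) * r - (x - y) * ((p + q) / (2 * r))) / r ^ 2 =
      (A * (x * (x + 3 * y)) - B * (y * (3 * x + y))) / (2 * r ^ 3) := by
    rw [hp, hq]
    field_simp
    rw [hr2]
    ring
  rw [e1, div_pow, ← mul_div_assoc, div_le_iff₀ (by positivity)]
  have e2 : (2 * r ^ 3) ^ 2 = 4 * (x + y) ^ 3 := by
    rw [← hr2]
    ring
  rw [e2]
  -- Cauchy–Schwarz, then `2 (x + y)⁴ - (x (x + 3y))² - (y (3x + y))²` is a nonnegative polynomial
  have h1 : (A * (x * (x + 3 * y)) - B * (y * (3 * x + y))) ^ 2 ≤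
      (A ^ 2 + B ^ 2) * ((x * (x + 3 * y)) ^ 2 + (y * (3 * x + y)) ^ 2) := by
    nlinarith [sq_nonneg (A * (y * (3 * x + y)) + B * (x * (x + 3 * y)))]
  have h2 : (x * (x + 3 * y)) ^ 2 + (y * (3 * x + y)) ^ 2 ≤ 2 * (x + y) ^ 4 := by
    have h3 : 0 ≤ (x - y) ^ 2 * (x ^ 2 + 4 * x * y + y ^ 2) := by positivity
    nlinarith
  have h4 := mul_le_mul_of_nonneg_left h2 (by positivity : 0 ≤ A ^ 2 + B ^ 2)
  nlinarith

/-- The inequality on a circle from which the constant `d - 2` comes, by summation over `d - 2`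
orthogonal directions. -/
lemma circle_inequality {F F' : ℝ → ℝ} (hF : ∀ t, HasDerivAt F (F' t) t) (hF' : Continuous F')
    (hpos : ∀ t, 0 < F t) (hper : ∀ t, F (t + 2 * Real.pi) = F t) :
    ∫ t in (0 : ℝ)..Real.pi, (F (t + Real.pi) - F t) ^ 2 / (F (t + Real.pi) + F t) ≤
      ∫ t in (0 : ℝ)..Real.pi, 1 / 2 * (F t + F (t + Real.pi)) *
        ((F' t / F t) ^ 2 + (F' (t + Real.pi) / F (t + Real.pi)) ^ 2) := by
  have hcF : Continuous F := continuous_iff_continuousAt.2 fun t => (hF t).continuousAt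
  have hsum : ∀ t, 0 < F t + F (t + Real.pi) := fun t => add_pos (hpos _) (hpos _)
  have hF1 : ∀ t, HasDerivAt (fun t => F (t + Real.pi)) (F' (t + Real.pi)) t := fun t =>
    (hF (t + Real.pi)).comp_add_const t Real.pi
  let φ : ℝ → ℝ := fun t => (F t - F (t + Real.pi)) / √(F t + F (t + Real.pi))
  let φ' : ℝ → ℝ := fun t => ((F' t - F' (t + Real.pi)) * √(F t + F (t + Real.pi)) -
    (F t - F (t + Real.pi)) * ((F' t + F' (t + Real.pi)) / (2 * √(F t + F (t + Real.pi))))) /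
      √(F t + F (t + Real.pi)) ^ 2
  have hφ : ∀ t, HasDerivAt φ (φ' t) t := fun t =>
    ((hF t).sub (hF1 t)).div (((hF t).add (hF1 t)).sqrt (hsum t).ne')
      (Real.sqrt_pos.2 (hsum t)).ne'
  have hsq : ∀ t, √(F t + F (t + Real.pi)) ≠ 0 := fun t => (Real.sqrt_pos.2 (hsum t)).ne'
  have hφ'c : Continuous φ' := by
    refine Continuous.div ?_ (by fun_prop) fun t => pow_ne_zero 2 (hsq t)
    refine (by fun_prop : Continuous fun t => (F' t - F' (t + Real.pi)) *
      √(F t + F (t + Real.pi))).sub ((by fun_prop : Continuous fun t => F t - F (t + Real.pi)).mul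
      (Continuous.div (by fun_prop) (by fun_prop) fun t => mul_ne_zero two_ne_zero (hsq t)))
  have hanti : ∀ t, φ (t + Real.pi) = -φ t := fun t => by
    have : F (t + Real.pi + Real.pi) = F t := by
      rw [← hper t]
      congr 1
      ring
    simp only [φ, this]
    rw [add_comm (F (t + Real.pi)), ← neg_div, neg_sub]
  have h1 := integral_sq_le_of_antiperiodic hφ hφ'c hanti
  have e1 : ∀ t, φ t ^ 2 = (F (t + Real.pi) - F t) ^ 2 / (F (t + Real.pi) + F t) := fun t => by
    simp only [φ]
    rw [div_pow, Real.sq_sqrt (hsum t).le, add_comm (F (t + Real.pi))]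
    congr 1
    ring
  simp only [e1] at h1
  refine h1.trans (intervalIntegral.integral_mono_on Real.pi_pos.le
    ((hφ'c.pow 2).intervalIntegrable _ _) (Continuous.intervalIntegrable ?_ _ _) fun t _ => ?_)
  · have ha : Continuous fun t => F' t / F t := hF'.div hcF fun t => (hpos t).ne'
    have hb : Continuous fun t => F' (t + Real.pi) / F (t + Real.pi) :=
      ha.comp (continuous_id.add continuous_const)
    fun_prop
  · have := two_mul_sq_deriv_le (p := F' t) (q := F' (t + Real.pi)) (hpos t) (hpos (t + Real.pi))
    change φ' t ^ 2 ≤ _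
    simp only [φ']
    linarith

end

/-! ### Averages over the orthogonal group -/

section

variable {d : ℕ}

section OrthogonalGroup

variable {V : Type*} [NormedAddCommGroup V] [InnerProductSpace ℝ V]

instance [CompleteSpace V] : IsTopologicalGroup (unitary (V →L[ℝ] V)) where
  continuous_inv := (continuous_star.comp continuous_subtype_val).subtype_mk _

instance [FiniteDimensional ℝ V] : CompactSpace (unitary (V →L[ℝ] V)) := by
  have h : IsCompact (unitary (V →L[ℝ] V) : Set (V →L[ℝ] V)) := by
    refine Metric.isCompact_of_isClosed_isBounded ?_ ?_
    · have : (unitary (V →L[ℝ] V) : Set (V →L[ℝ] V)) =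
          {A | star A * A = 1} ∩ {A | A * star A = 1} := by
        ext A
        exact Unitary.mem_iff
      rw [this]
      exact (isClosed_eq (continuous_star.mul continuous_id) continuous_const).inter
        (isClosed_eq (continuous_id.mul continuous_star) continuous_const)
    · refine (Metric.isBounded_iff_subset_closedBall 0).2 ⟨1, fun A hA => ?_⟩
      rw [mem_closedBall_zero_iff]
      refine A.opNorm_le_bound zero_le_one fun x => ?_
      rw [one_mul]
      exact (Unitary.norm_map ⟨A, hA⟩ x).le
  exact isCompact_iff_compactSpace.1 h

/-- A random isometry `ξ ↦ U ξ` whose law is invariant under composition on the right with a fixed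
isometry. -/
structure IsInvariantFamily {Ω : Type*} [TopologicalSpace Ω] [MeasurableSpace Ω] (P : Measure Ω)
    (U : Ω → V ≃ₗᵢ[ℝ] V) : Prop where
  continuous : Continuous fun p : Ω × V => U p.1 p.2
  lintegral_comp : ∀ (R : V ≃ₗᵢ[ℝ] V) (W : (V ≃ₗᵢ[ℝ] V) → ℝ≥0∞),
    ∫⁻ ξ, W (R.trans (U ξ)) ∂P = ∫⁻ ξ, W (U ξ) ∂P

/-- The inverse of a Haar-distributed element of the orthogonal group is an invariant family; with
the inverse, composition on the right becomes translation of the group on the left. -/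
lemma isInvariantFamily_haar [FiniteDimensional ℝ V] :
    IsInvariantFamily (Measure.haarMeasure (⊤ : TopologicalSpace.PositiveCompacts
      (unitary (V →L[ℝ] V)))) (fun U => Unitary.linearIsometryEquiv U⁻¹) := by
  refine ⟨?_, fun R W => ?_⟩
  · exact ((continuous_subtype_val.comp (continuous_inv.comp continuous_fst)).clm_apply
      continuous_snd : Continuous fun p : unitary (V →L[ℝ] V) × V =>
        ((p.1⁻¹ : unitary (V →L[ℝ] V)) : V →L[ℝ] V) p.2)
  · rw [← lintegral_mul_left_eq_self (fun U => W (Unitary.linearIsometryEquiv U⁻¹))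
      (Unitary.linearIsometryEquiv.symm R)⁻¹]
    refine lintegral_congr fun U => congrArg W ?_
    rw [mul_inv_rev, inv_inv, map_mul, MulEquiv.apply_symm_apply]
    rfl

lemma isProbabilityMeasure_haar [FiniteDimensional ℝ V] :
    IsProbabilityMeasure (Measure.haarMeasure (⊤ : TopologicalSpace.PositiveCompacts
      (unitary (V →L[ℝ] V)))) := by
  refine ⟨?_⟩
  simpa using Measure.haarMeasure_self
    (K₀ := (⊤ : TopologicalSpace.PositiveCompacts (unitary (V →L[ℝ] V))))

end OrthogonalGroup

variable {Ω : Type*} [TopologicalSpace Ω] [MeasurableSpace Ω] [BorelSpace Ω]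
  [SecondCountableTopology Ω] {P : Measure Ω} [IsProbabilityMeasure P]

/-- An integral over pairs against a kernel depending on `σ' · σ` only does not change when the
integrand is averaged over a family of isometries. -/
lemma IsInvariantFamily.lintegral_pair_eq {U : Ω → E d ≃ₗᵢ[ℝ] E d} (hU : IsInvariantFamily P U)
    {W : S d → S d → ℝ≥0∞} (hW : Measurable (Function.uncurry W))
    {β : ℝ → ℝ≥0∞} (hβ : Measurable β) :
    ∫⁻ σ, ∫⁻ σ', W σ σ' * β (dot σ' σ) ∂(surf d) ∂(surf d) =
      ∫⁻ σ, ∫⁻ σ', (∫⁻ ξ, W (sphMap (U ξ) σ) (sphMap (U ξ) σ') ∂P) *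
        β (dot σ' σ) ∂(surf d) ∂(surf d) := by
  have hact : Continuous fun p : Ω × S d => sphMap (U p.1) p.2 :=
    (hU.continuous.comp (continuous_fst.prodMk
      (continuous_subtype_val.comp continuous_snd))).subtype_mk _
  have hβ2 : Measurable fun p : S d × S d => β (dot p.2 p.1) :=
    hβ.comp (continuous_dot.comp continuous_swap).measurable
  have hWU : Measurable fun q : Ω × S d × S d =>
      W (sphMap (U q.1) q.2.1) (sphMap (U q.1) q.2.2) :=
    hW.comp ((hact.comp (continuous_fst.prodMk (continuous_fst.comp continuous_snd))).prodMk
      (hact.comp (continuous_fst.prodMk (continuous_snd.comp continuous_snd)))).measurable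
  have hK : ∀ ξ : Ω, ∫⁻ σ, ∫⁻ σ', W (sphMap (U ξ) σ) (sphMap (U ξ) σ') *
      β (dot σ' σ) ∂(surf d) ∂(surf d) = ∫⁻ σ, ∫⁻ σ', W σ σ' * β (dot σ' σ) ∂(surf d) ∂(surf d) := by
    intro ξ
    have hm : Measurable fun p : S d × S d => W p.1 p.2 * β (dot p.2 p.1) := hW.mul hβ2
    have h1 : ∀ σ, ∫⁻ σ', W (sphMap (U ξ) σ) (sphMap (U ξ) σ') * β (dot σ' σ)
        ∂(surf d) = ∫⁻ σ', W (sphMap (U ξ) σ) σ' * β (dot σ' (sphMap (U ξ) σ))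
          ∂(surf d) := fun σ => by
      rw [← (measurePreserving_sphMap (U ξ)).lintegral_comp
        (f := fun σ' => W (sphMap (U ξ) σ) σ' * β (dot σ' (sphMap (U ξ) σ)))
        (hm.comp (measurable_const.prodMk measurable_id))]
      simp only [dot_sphMap]
    simp only [h1]
    exact (measurePreserving_sphMap (U ξ)).lintegral_comp
      (f := fun σ => ∫⁻ σ', W σ σ' * β (dot σ' σ) ∂(surf d)) hm.lintegral_prod_right'
  calc _ = ∫⁻ ξ, ∫⁻ σ, ∫⁻ σ', W (sphMap (U ξ) σ) (sphMap (U ξ) σ') *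
      β (dot σ' σ) ∂(surf d) ∂(surf d) ∂P := by
        simp only [hK, lintegral_const, measure_univ, mul_one]
    _ = ∫⁻ σ, ∫⁻ ξ, ∫⁻ σ', W (sphMap (U ξ) σ) (sphMap (U ξ) σ') *
      β (dot σ' σ) ∂(surf d) ∂P ∂(surf d) := by
        refine lintegral_lintegral_swap (Measurable.aemeasurable ?_)
        have : Measurable fun q : (Ω × S d) × S d =>
            W (sphMap (U q.1.1) q.1.2) (sphMap (U q.1.1) q.2) * β (dot q.2 q.1.2) :=
          (hWU.comp ((measurable_fst.comp measurable_fst).prodMk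
            ((measurable_snd.comp measurable_fst).prodMk measurable_snd))).mul
            (hβ2.comp ((measurable_snd.comp measurable_fst).prodMk measurable_snd))
        exact this.lintegral_prod_right'
    _ = ∫⁻ σ, ∫⁻ σ', ∫⁻ ξ, W (sphMap (U ξ) σ) (sphMap (U ξ) σ') *
      β (dot σ' σ) ∂P ∂(surf d) ∂(surf d) := by
        refine lintegral_congr fun σ => lintegral_lintegral_swap (Measurable.aemeasurable ?_)
        exact (hWU.comp (measurable_fst.prodMk (measurable_const.prodMk measurable_snd))).mul
          (hβ2.comp (measurable_const.prodMk measurable_snd))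
    _ = _ := by
        refine lintegral_congr fun σ => lintegral_congr fun σ' => ?_
        exact lintegral_mul_const _
          (hWU.comp (measurable_id.prodMk (measurable_const.prodMk measurable_const)))

/-- The rotation by the angle `t` in the plane of two orthonormal vectors `u`, `e`, as the product
of the reflections through the lines spanned by `u` and by `cos (t / 2) u + sin (t / 2) e`. -/
lemma exists_rotation {u e : E d} (hu : ‖u‖ = 1) (he : ‖e‖ = 1) (hue : inner ℝ u e = (0 : ℝ))
    (t : ℝ) : ∃ R : E d ≃ₗᵢ[ℝ] E d, R u = Real.cos t • u + Real.sin t • e ∧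
      R e = -Real.sin t • u + Real.cos t • e ∧
      ∀ m : E d, inner ℝ u m = (0 : ℝ) → inner ℝ e m = (0 : ℝ) → R m = m := by
  set c := Real.cos (t / 2) with hc
  set s := Real.sin (t / 2) with hs
  have hcs : c ^ 2 + s ^ 2 = 1 := Real.cos_sq_add_sin_sq _
  have hcos : Real.cos t = 2 * c ^ 2 - 1 := by
    rw [hc, ← Real.cos_two_mul]
    congr 1
    ring
  have hsin : Real.sin t = 2 * s * c := by
    rw [hc, hs, ← Real.sin_two_mul]
    congr 1
    ring
  have huu : inner ℝ u u = (1 : ℝ) := by rw [real_inner_self_eq_norm_sq, hu]; norm_num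
  have hee : inner ℝ e e = (1 : ℝ) := by rw [real_inner_self_eq_norm_sq, he]; norm_num
  have heu : inner ℝ e u = (0 : ℝ) := by rw [real_inner_comm, hue]
  set w : E d := c • u + s • e with hw
  have hwn : ‖w‖ = 1 := by
    have : ‖w‖ ^ 2 = 1 := by
      rw [← real_inner_self_eq_norm_sq, hw]
      simp only [inner_add_left, inner_add_right, inner_smul_left, inner_smul_right, huu, hee, hue,
        heu]
      simp
      linarith
    nlinarith [norm_nonneg w]
  have hwu : inner ℝ w u = c := by
    rw [hw]
    simp only [inner_add_left, inner_smul_left, huu, heu]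
    simp
  have hwe : inner ℝ w e = s := by
    rw [hw]
    simp only [inner_add_left, inner_smul_left, hue, hee]
    simp
  refine ⟨(lineRefl u).trans (lineRefl w), ?_, ?_, fun m hm hm' => ?_⟩
  · rw [LinearIsometryEquiv.trans_apply, lineRefl_apply_of_norm hu, huu,
      lineRefl_apply_of_norm hwn, inner_sub_right, inner_smul_right, hwu, hcos, hsin, hw]
    module
  · rw [LinearIsometryEquiv.trans_apply, lineRefl_apply_of_norm hu, hue,
      lineRefl_apply_of_norm hwn, inner_sub_right, inner_smul_right, hwu, hwe, hcos, hsin, hw]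
    have : s ^ 2 = 1 - c ^ 2 := by linarith
    have h2 : 2 * c ^ 2 - 1 = 1 - 2 * s ^ 2 := by linarith
    rw [h2]
    module
  · have hwm : inner ℝ w m = (0 : ℝ) := by
      rw [hw]
      simp [inner_add_left, inner_smul_left, hm, hm']
    rw [LinearIsometryEquiv.trans_apply, lineRefl_apply_of_norm hu, hm,
      lineRefl_apply_of_norm hwn, inner_sub_right, inner_smul_right, hwm]
    simp

end

/-! ### The inequality for a pair of points -/

section

lemma rotEnergy_eq {d : ℕ} {h : E d → ℝ} (hh : EvenHom h) (σ τ : S d) :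
    rotEnergy h σ τ = ‖sphGrad (fun τ : S d => h τ) σ‖ ^ 2 + ‖sphGrad (fun τ : S d => h τ) τ‖ ^ 2
      - 2 * (inner ℝ (σ : E d) (τ : E d) *
          inner ℝ (sphGrad (fun τ : S d => h τ) σ) (sphGrad (fun τ : S d => h τ) τ)
        - inner ℝ (σ : E d) (sphGrad (fun τ : S d => h τ) τ) *
          inner ℝ (sphGrad (fun τ : S d => h τ) σ) (τ : E d)) := by
  set p := sphGrad (fun τ : S d => h τ) σ with hp
  set q := sphGrad (fun τ : S d => h τ) τ with hq
  have h1 := sum_minors (σ : E d) p σ p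
  have h2 := sum_minors (τ : E d) q τ q
  have h3 := sum_minors (σ : E d) p τ q
  have h4 : ∑ i, ∑ j, (rotDeriv h i j τ - rotDeriv h i j σ) ^ 2 =
      ∑ i, ∑ j, ((σ : E d) i * p j - (σ : E d) j * p i) * ((σ : E d) i * p j - (σ : E d) j * p i) +
      ∑ i, ∑ j, ((τ : E d) i * q j - (τ : E d) j * q i) * ((τ : E d) i * q j - (τ : E d) j * q i) -
      2 * ∑ i, ∑ j,
        ((σ : E d) i * p j - (σ : E d) j * p i) * ((τ : E d) i * q j - (τ : E d) j * q i) := by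
    simp only [Finset.mul_sum, ← Finset.sum_add_distrib, ← Finset.sum_sub_distrib,
      rotDeriv_coe hh, ← hp, ← hq]
    refine Finset.sum_congr rfl fun i _ => Finset.sum_congr rfl fun j _ => ?_
    ring
  have hσp : inner ℝ (σ : E d) p = 0 := inner_coe_sphGrad hh σ
  have hτq : inner ℝ (τ : E d) q = 0 := inner_coe_sphGrad hh τ
  rw [rotEnergy, h4, h1, h2, h3, hσp, hτq]
  simp only [real_inner_self_eq_norm_sq, norm_coe_S]
  ring

/-- If `σ` and `τ` are symmetric with respect to the line of `B 0` in the plane of `B 0` and `B 1`,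
the derivatives in the `n` directions orthogonal to that plane control the rotational energy. -/
lemma rotEnergy_ge {n : ℕ} {h : E (n + 2) → ℝ} (hh : EvenHom h) {σ τ : S (n + 2)}
    (B : OrthonormalBasis (Fin (n + 2)) ℝ (E (n + 2))) {α β : ℝ} (hαβ : α ^ 2 + β ^ 2 = 1)
    (hle : β ^ 2 ≤ α ^ 2) (hσ : (σ : E (n + 2)) = α • B 0 + β • B 1)
    (hτ : (τ : E (n + 2)) = α • B 0 - β • B 1) :
    2 * β ^ 2 * ∑ i : Fin n, (fderiv ℝ h σ (B i.succ.succ) ^ 2 + fderiv ℝ h τ (B i.succ.succ) ^ 2)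
      ≤ rotEnergy h σ τ := by
  have hσp := inner_coe_sphGrad hh σ
  have hτq := inner_coe_sphGrad hh τ
  rw [rotEnergy_eq hh]
  simp only [← hh.inner_sphGrad]
  set p := sphGrad (fun τ : S (n + 2) => h τ) σ
  set q := sphGrad (fun τ : S (n + 2) => h τ) τ
  have hB := orthonormal_iff_ite.1 B.orthonormal
  have hin : ∀ u v : E (n + 2), inner ℝ u v = inner ℝ u (B 0) * inner ℝ v (B 0) +
      (inner ℝ u (B 1) * inner ℝ v (B 1) +
        ∑ i : Fin n, inner ℝ u (B i.succ.succ) * inner ℝ v (B i.succ.succ)) := fun u v => by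
    rw [← B.sum_inner_mul_inner u v, Fin.sum_univ_succ, Fin.sum_univ_succ]
    simp only [real_inner_comm v, Fin.succ_zero_eq_one]
  have hστ : inner ℝ (σ : E (n + 2)) (τ : E (n + 2)) = α ^ 2 - β ^ 2 := by
    rw [hσ, hτ]
    simp [inner_add_left, inner_sub_right, inner_smul_left, inner_smul_right, hB]
    ring
  have hσv : ∀ v, inner ℝ (σ : E (n + 2)) v = α * inner ℝ v (B 0) + β * inner ℝ v (B 1) := fun v => by
    rw [hσ, inner_add_left, inner_smul_left, inner_smul_left, real_inner_comm v, real_inner_comm v]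
    rfl
  have hτv : ∀ v, inner ℝ (τ : E (n + 2)) v = α * inner ℝ v (B 0) - β * inner ℝ v (B 1) := fun v => by
    rw [hτ, inner_sub_left, inner_smul_left, inner_smul_left, real_inner_comm v, real_inner_comm v]
    rfl
  have hpτ : inner ℝ p (τ : E (n + 2)) = inner ℝ (τ : E (n + 2)) p := real_inner_comm _ _
  rw [hστ, hσv q, hpτ, hτv p, ← real_inner_self_eq_norm_sq,
    ← real_inner_self_eq_norm_sq, hin p p, hin q q, hin p q]
  rw [hσv] at hσp
  rw [hτv] at hτq
  set p0 := inner ℝ p (B 0)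
  set p1 := inner ℝ p (B 1)
  set q0 := inner ℝ q (B 0)
  set q1 := inner ℝ q (B 1)
  -- the components in the plane contribute a square
  have hplane : 0 ≤ p0 ^ 2 + p1 ^ 2 + q0 ^ 2 + q1 ^ 2 - 2 * ((α ^ 2 - β ^ 2) * (p0 * q0 + p1 * q1)
      - (α * q0 + β * q1) * (α * p0 - β * p1)) := by
    obtain ⟨s, hs0, hs1⟩ : ∃ s, p0 = -β * s ∧ p1 = α * s :=
      ⟨α * p1 - β * p0, by linear_combination (-p0) * hαβ + α * hσp,
        by linear_combination (-p1) * hαβ + β * hσp⟩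
    obtain ⟨r, hr0, hr1⟩ : ∃ r, q0 = β * r ∧ q1 = α * r :=
      ⟨α * q1 + β * q0, by linear_combination (-q0) * hαβ + α * hτq,
        by linear_combination (-q1) * hαβ - β * hτq⟩
    rw [hs0, hs1, hr0, hr1]
    refine (sq_nonneg (s - r)).trans_eq ?_
    linear_combination (2 * s * r * (α ^ 2 + β ^ 2 + 1) - s ^ 2 - r ^ 2) * hαβ
  have hperp : 2 * β ^ 2 * ∑ i : Fin n, (inner ℝ p (B i.succ.succ) ^ 2 +
      inner ℝ q (B i.succ.succ) ^ 2) ≤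
      ∑ i : Fin n, inner ℝ p (B i.succ.succ) * inner ℝ p (B i.succ.succ) +
      ∑ i : Fin n, inner ℝ q (B i.succ.succ) * inner ℝ q (B i.succ.succ) -
      2 * ((α ^ 2 - β ^ 2) *
        ∑ i : Fin n, inner ℝ p (B i.succ.succ) * inner ℝ q (B i.succ.succ)) := by
    simp only [Finset.mul_sum, ← Finset.sum_add_distrib, ← Finset.sum_sub_distrib]
    refine Finset.sum_le_sum fun i _ => ?_
    set x := inner ℝ p (B i.succ.succ)
    set y := inner ℝ q (B i.succ.succ)
    have h1 : α ^ 2 = 1 - β ^ 2 := by linarith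
    have h2 : 0 ≤ (α ^ 2 - β ^ 2) * (x - y) ^ 2 :=
      mul_nonneg (by linarith) (sq_nonneg _)
    rw [h1] at h2 ⊢
    nlinarith
  nlinarith [hplane, hperp]

variable {d : ℕ}

/-- The integrand `(k y - k x)² / (k y + k x)` of the jump energy. -/
noncomputable def jumpDensity (k : E d → ℝ) (x y : E d) : ℝ := (k y - k x) ^ 2 / (k y + k x)

/-- The Fisher information of `k` at the pair `(x, y)`, in the direction `v`. -/
noncomputable def dirFisher (k : E d → ℝ) (x y v : E d) : ℝ :=
  1 / 2 * (k x + k y) * ((fderiv ℝ k x v / k x) ^ 2 + (fderiv ℝ k y v / k y) ^ 2)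

lemma EvenHom.continuous_comp {k : E d → ℝ} (hk : EvenHom k) {Y : Type*} [TopologicalSpace Y]
    {x : Y → E d} (hx : Continuous x) (hx0 : ∀ y, x y ≠ 0) : Continuous fun y => k (x y) :=
  continuous_iff_continuousAt.2 fun y => ContinuousAt.comp (g := k) (f := x)
    (hk.contDiffAt _ (hx0 y)).continuousAt hx.continuousAt

lemma EvenHom.continuous_fderiv_comp {k : E d → ℝ} (hk : EvenHom k) {Y : Type*}
    [TopologicalSpace Y] {x v : Y → E d} (hx : Continuous x) (hx0 : ∀ y, x y ≠ 0)
    (hv : Continuous v) : Continuous fun y => fderiv ℝ k (x y) (v y) := by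
  have : Continuous fun y => fderiv ℝ k (x y) :=
    continuous_iff_continuousAt.2 fun y => ContinuousAt.comp (g := fderiv ℝ k) (f := x)
      ((hk.contDiffAt _ (hx0 y)).fderiv_right (m := ∞) (by simp)).continuousAt hx.continuousAt
  exact this.clm_apply hv

section Continuity

variable {k : E d → ℝ} {Y : Type*} [TopologicalSpace Y] {x y v : Y → E d}

lemma EvenHom.continuous_jumpDensity (hk : EvenHom k) (hpos : ∀ x, x ≠ 0 → 0 < k x)
    (hx : Continuous x) (hx0 : ∀ t, x t ≠ 0) (hy : Continuous y) (hy0 : ∀ t, y t ≠ 0) :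
    Continuous fun t => jumpDensity k (x t) (y t) := by
  have h1 := hk.continuous_comp hx hx0
  have h2 := hk.continuous_comp hy hy0
  exact ((h2.sub h1).pow 2).div (h2.add h1) fun t =>
    (add_pos (hpos _ (hy0 t)) (hpos _ (hx0 t))).ne'

lemma EvenHom.continuous_dirFisher (hk : EvenHom k) (hpos : ∀ x, x ≠ 0 → 0 < k x)
    (hx : Continuous x) (hx0 : ∀ t, x t ≠ 0) (hy : Continuous y) (hy0 : ∀ t, y t ≠ 0)
    (hv : Continuous v) : Continuous fun t => dirFisher k (x t) (y t) (v t) := by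
  have h1 := hk.continuous_comp hx hx0
  have h2 := hk.continuous_comp hy hy0
  have h3 := (hk.continuous_fderiv_comp hx hx0 hv).div h1 fun t => (hpos _ (hx0 t)).ne'
  have h4 := (hk.continuous_fderiv_comp hy hy0 hv).div h2 fun t => (hpos _ (hy0 t)).ne'
  exact (continuous_const.mul (h1.add h2)).mul ((h3.pow 2).add (h4.pow 2))

end Continuity

lemma jumpDensity_nonneg {k : E d → ℝ} (hpos : ∀ x, x ≠ 0 → 0 < k x) {x y : E d} (hx : x ≠ 0)
    (hy : y ≠ 0) : 0 ≤ jumpDensity k x y :=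
  div_nonneg (sq_nonneg _) (add_pos (hpos y hy) (hpos x hx)).le

lemma dirFisher_nonneg {k : E d → ℝ} (hpos : ∀ x, x ≠ 0 → 0 < k x) {x y : E d} (hx : x ≠ 0)
    (hy : y ≠ 0) (v : E d) : 0 ≤ dirFisher k x y v := by
  have := hpos x hx
  have := hpos y hy
  unfold dirFisher
  positivity

lemma lintegral_ofReal_le_of_intervalIntegral_le {f g : ℝ → ℝ} (hf : Continuous f)
    (hg : Continuous g) (hf0 : ∀ t, 0 ≤ f t) (hg0 : ∀ t, 0 ≤ g t) {a : ℝ} (ha : 0 ≤ a)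
    (h : ∫ t in (0 : ℝ)..a, f t ≤ ∫ t in (0 : ℝ)..a, g t) :
    ∫⁻ t in Ioc 0 a, ENNReal.ofReal (f t) ≤ ∫⁻ t in Ioc 0 a, ENNReal.ofReal (g t) := by
  rw [intervalIntegral.integral_of_le ha, intervalIntegral.integral_of_le ha] at h
  have h1 : ∀ {f : ℝ → ℝ}, Continuous f → (∀ t, 0 ≤ f t) →
      ENNReal.ofReal (∫ t in Ioc 0 a, f t) = ∫⁻ t in Ioc 0 a, ENNReal.ofReal (f t) :=
    fun hf hf0 => ofReal_integral_eq_lintegral_ofReal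
      (hf.integrableOn_Ioc) (Eventually.of_forall hf0)
  rw [← h1 hf hf0, ← h1 hg hg0]
  exact ENNReal.ofReal_le_ofReal h

variable {Ω : Type*} [TopologicalSpace Ω] [MeasurableSpace Ω] [BorelSpace Ω]
  [SecondCountableTopology Ω] {P : Measure Ω} [IsProbabilityMeasure P]
  {U : Ω → E d ≃ₗᵢ[ℝ] E d}

/-- The jump between two points `α m ± β u` is controlled, in mean over all isometries, by the
derivatives in any direction `e` orthogonal to both: rotate in the plane of `u` and `e`, which after
half a turn exchanges the two points, and use the inequality on the circle. -/
lemma IsInvariantFamily.lintegral_jumpDensity_le (hU : IsInvariantFamily P U) {k : E d → ℝ}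
    (hk : EvenHom k) (hpos : ∀ x, x ≠ 0 → 0 < k x) {m u e : E d} (hu : ‖u‖ = 1) (he : ‖e‖ = 1)
    (hue : inner ℝ u e = (0 : ℝ)) (hum : inner ℝ u m = (0 : ℝ)) (hem : inner ℝ e m = (0 : ℝ))
    {α β : ℝ} (h0 : α • m + β • u ≠ 0) :
    ∫⁻ ξ, ENNReal.ofReal (jumpDensity k (U ξ (α • m + β • u)) (U ξ (α • m - β • u))) ∂P ≤
      ∫⁻ ξ, ENNReal.ofReal
        (dirFisher k (U ξ (α • m + β • u)) (U ξ (α • m - β • u)) (U ξ (β • e))) ∂P := by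
  let γ : ℝ → E d := fun t => α • m + β • (Real.cos t • u + Real.sin t • e)
  let η : ℝ → E d := fun t => β • (-Real.sin t • u + Real.cos t • e)
  have hγπ : ∀ t, γ (t + Real.pi) = α • m - β • (Real.cos t • u + Real.sin t • e) := fun t => by
    simp only [γ, Real.cos_add_pi, Real.sin_add_pi]
    module
  have hηπ : ∀ t, η (t + Real.pi) = -η t := fun t => by
    simp only [η, Real.cos_add_pi, Real.sin_add_pi]
    module
  have hγc : Continuous γ := by fun_prop
  have hηc : Continuous η := by fun_prop
  have hγd : ∀ t, HasDerivAt γ (η t) t := fun t =>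
    ((((Real.hasDerivAt_cos t).smul_const u).add
      ((Real.hasDerivAt_sin t).smul_const e)).const_smul β).const_add (α • m)
  choose R hRu hRe hRm using exists_rotation hu he hue
  have hR1 : ∀ t, R t (α • m + β • u) = γ t := fun t => by
    simp only [map_add, map_smul, hRu, hRm t m hum hem, γ]
  have hR2 : ∀ t, R t (α • m - β • u) = γ (t + Real.pi) := fun t => by
    simp only [map_sub, map_smul, hRu, hRm t m hum hem, hγπ]
  have hR3 : ∀ t, R t (β • e) = η t := fun t => by simp only [map_smul, hRe, η]
  have hγ0 : ∀ t, γ t ≠ 0 := fun t => by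
    rw [← hR1]
    exact fun h => h0 ((R t).map_eq_zero_iff.1 h)
  have hUγ0 : ∀ ξ t, U ξ (γ t) ≠ 0 := fun ξ t => by simpa using hγ0 t
  let J : Ω → ℝ → ℝ≥0∞ := fun ξ t =>
    ENNReal.ofReal (jumpDensity k (U ξ (γ t)) (U ξ (γ (t + Real.pi))))
  let K : Ω → ℝ → ℝ≥0∞ := fun ξ t =>
    ENNReal.ofReal (dirFisher k (U ξ (γ t)) (U ξ (γ (t + Real.pi))) (U ξ (η t)))
  have c1 : Continuous fun p : Ω × ℝ => U p.1 (γ p.2) :=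
    hU.continuous.comp (continuous_fst.prodMk (hγc.comp continuous_snd))
  have c2 : Continuous fun p : Ω × ℝ => U p.1 (γ (p.2 + Real.pi)) :=
    hU.continuous.comp (continuous_fst.prodMk (hγc.comp (continuous_snd.add continuous_const)))
  have c3 : Continuous fun p : Ω × ℝ => U p.1 (η p.2) :=
    hU.continuous.comp (continuous_fst.prodMk (hηc.comp continuous_snd))
  have cJ := hk.continuous_jumpDensity hpos c1 (fun p => hUγ0 _ _) c2 (fun p => hUγ0 _ _)
  have cK := hk.continuous_dirFisher hpos c1 (fun p => hUγ0 _ _) c2 (fun p => hUγ0 _ _) c3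
  have hJ : ∀ t, ∫⁻ ξ, J ξ t ∂P =
      ∫⁻ ξ, ENNReal.ofReal (jumpDensity k (U ξ (α • m + β • u)) (U ξ (α • m - β • u))) ∂P :=
    fun t => by
      rw [← hU.lintegral_comp (R t) fun V =>
        ENNReal.ofReal (jumpDensity k (V (α • m + β • u)) (V (α • m - β • u)))]
      simp only [LinearIsometryEquiv.trans_apply, hR1, hR2, J]
  have hK : ∀ t, ∫⁻ ξ, K ξ t ∂P = ∫⁻ ξ, ENNReal.ofReal
      (dirFisher k (U ξ (α • m + β • u)) (U ξ (α • m - β • u)) (U ξ (β • e))) ∂P :=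
    fun t => by
      rw [← hU.lintegral_comp (R t) fun V => ENNReal.ofReal
        (dirFisher k (V (α • m + β • u)) (V (α • m - β • u)) (V (β • e)))]
      simp only [LinearIsometryEquiv.trans_apply, hR1, hR2, hR3, K]
  -- the inequality on the circle, for each isometry of the family
  have hcircle : ∀ ξ, ∫⁻ t in Ioc 0 Real.pi, J ξ t ≤ ∫⁻ t in Ioc 0 Real.pi, K ξ t := by
    intro ξ
    have hF : ∀ t, HasDerivAt (fun t => k (U ξ (γ t))) (fderiv ℝ k (U ξ (γ t)) (U ξ (η t))) t :=
      fun t => (hk.differentiableAt (hUγ0 ξ t)).hasFDerivAt.comp_hasDerivAt t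
        ((U ξ : E d →L[ℝ] E d).hasFDerivAt.comp_hasDerivAt t (hγd t))
    have cs : Continuous fun t : ℝ => (ξ, t) := by fun_prop
    have hF' : Continuous fun t => fderiv ℝ k (U ξ (γ t)) (U ξ (η t)) :=
      hk.continuous_fderiv_comp (c1.comp cs) (fun t => hUγ0 ξ t) (c3.comp cs)
    have h1 := circle_inequality hF hF' (fun t => hpos _ (hUγ0 ξ t)) (fun t => by
      simp only [γ, Real.cos_add_two_pi, Real.sin_add_two_pi])
    refine lintegral_ofReal_le_of_intervalIntegral_le (cJ.comp cs) (cK.comp cs)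
      (fun t => jumpDensity_nonneg hpos (hUγ0 _ _) (hUγ0 _ _))
      (fun t => dirFisher_nonneg hpos (hUγ0 _ _) (hUγ0 _ _) _) Real.pi_pos.le ?_
    refine h1.trans_eq ?_
    congr 1
    funext t
    simp only [Function.comp_apply, dirFisher, hηπ, map_neg, neg_div, neg_sq]
  have hswap : ∀ {f : Ω → ℝ → ℝ≥0∞} {A : ℝ≥0∞}, Measurable (Function.uncurry f) →
      (∀ t, ∫⁻ ξ, f ξ t ∂P = A) →
      ∫⁻ ξ, (∫⁻ t in Ioc 0 Real.pi, f ξ t) ∂P = A * ENNReal.ofReal Real.pi := fun hf hA => by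
    rw [lintegral_lintegral_swap hf.aemeasurable]
    simp [hA]
  have h2 := lintegral_mono (μ := P) hcircle
  rw [hswap (f := J) cJ.measurable.ennreal_ofReal hJ,
    hswap (f := K) cK.measurable.ennreal_ofReal hK] at h2
  exact (ENNReal.mul_le_mul_iff_left (by simpa using Real.pi_pos) ENNReal.ofReal_ne_top).1 h2

end

section

section Pair

variable {n : ℕ} {Ω : Type*} [TopologicalSpace Ω] [MeasurableSpace Ω] [BorelSpace Ω]
  [SecondCountableTopology Ω] {P : Measure Ω} [IsProbabilityMeasure P]
  {U : Ω → E (n + 2) ≃ₗᵢ[ℝ] E (n + 2)}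

/-- The sum of the `n` directional Fisher informations is at most half the rotational energy of
`log k` times the mean of `k`. -/
lemma sum_dirFisher_le {k : E (n + 2) → ℝ} (hk : EvenHom k) (hpos : ∀ x, x ≠ 0 → 0 < k x)
    {σ τ : S (n + 2)} (B : OrthonormalBasis (Fin (n + 2)) ℝ (E (n + 2))) {α β : ℝ}
    (hαβ : α ^ 2 + β ^ 2 = 1) (hle : β ^ 2 ≤ α ^ 2)
    (hσ : (σ : E (n + 2)) = α • B 0 + β • B 1) (hτ : (τ : E (n + 2)) = α • B 0 - β • B 1) :
    ∑ i : Fin n, dirFisher k σ τ (β • B i.succ.succ) ≤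
      1 / 4 * (k σ + k τ) * rotEnergy (fun x => Real.log (k x)) σ τ := by
  have h1 := rotEnergy_ge (hk.log hpos) B hαβ hle hσ hτ
  have hlog : ∀ (ξ : S (n + 2)) v, fderiv ℝ (fun x => Real.log (k x)) ξ v =
      fderiv ℝ k ξ v / k ξ := fun ξ v => by
    rw [((hk.differentiableAt (coe_S_ne_zero ξ)).hasFDerivAt.log
      (hpos _ (coe_S_ne_zero ξ)).ne').fderiv]
    simp [div_eq_inv_mul]
  have hkσ := hpos _ (coe_S_ne_zero σ)
  have hkτ := hpos _ (coe_S_ne_zero τ)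
  calc ∑ i : Fin n, dirFisher k σ τ (β • B i.succ.succ)
      = 1 / 4 * (k σ + k τ) * (2 * β ^ 2 * ∑ i : Fin n,
          (fderiv ℝ (fun x => Real.log (k x)) σ (B i.succ.succ) ^ 2 +
            fderiv ℝ (fun x => Real.log (k x)) τ (B i.succ.succ) ^ 2)) := by
        simp only [Finset.mul_sum]
        refine Finset.sum_congr rfl fun i _ => ?_
        rw [hlog, hlog, dirFisher, map_smul, map_smul, smul_eq_mul, smul_eq_mul]
        ring
    _ ≤ _ := mul_le_mul_of_nonneg_left h1 (by positivity)

/-- Two distinct points of the sphere are symmetric in an orthonormal basis. -/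
lemma exists_symmetric_basis {σ τ : S (n + 2)} (hne : σ ≠ τ) (hc : 0 ≤ dot τ σ) :
    ∃ (B : OrthonormalBasis (Fin (n + 2)) ℝ (E (n + 2))) (α β : ℝ), α ^ 2 + β ^ 2 = 1 ∧
      β ^ 2 ≤ α ^ 2 ∧ (σ : E (n + 2)) = α • B 0 + β • B 1 ∧
      (τ : E (n + 2)) = α • B 0 - β • B 1 := by
  set a : E (n + 2) := (1 / 2 : ℝ) • ((σ : E (n + 2)) + τ) with ha
  set c : E (n + 2) := (1 / 2 : ℝ) • ((σ : E (n + 2)) - τ) with hc'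
  have hac : inner ℝ a c = (0 : ℝ) := by
    rw [ha, hc']
    simp only [inner_smul_left, inner_smul_right, inner_add_left, inner_add_right,
      inner_sub_right, real_inner_self_eq_norm_sq, norm_coe_S, real_inner_comm (σ : E (n + 2)), conj_trivial]
    ring
  have hdot : inner ℝ (σ : E (n + 2)) (τ : E (n + 2)) = dot τ σ := real_inner_comm _ _
  have hna : ‖a‖ ^ 2 = (1 + dot τ σ) / 2 := by
    rw [ha, norm_smul, mul_pow, norm_add_sq_real, norm_coe_S, norm_coe_S, hdot]
    norm_num
    ring
  have hnc : ‖c‖ ^ 2 = (1 - dot τ σ) / 2 := by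
    rw [hc', norm_smul, mul_pow, norm_sub_sq_real, norm_coe_S, norm_coe_S, hdot]
    norm_num
    ring
  have ha0 : ‖a‖ ≠ 0 := fun h => by
    rw [h] at hna
    linarith
  have hc0 : ‖c‖ ≠ 0 := by
    rw [norm_ne_zero_iff, hc']
    refine smul_ne_zero (by norm_num) (sub_ne_zero.2 fun h => hne (Subtype.ext h))
  let v : Fin (n + 2) → E (n + 2) := fun i => if i = 0 then ‖a‖⁻¹ • a else ‖c‖⁻¹ • c
  have hv : Orthonormal ℝ (({0, 1} : Set (Fin (n + 2))).domRestrict v) := by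
    have hn1 : ‖‖a‖⁻¹ • a‖ = 1 := by rw [norm_smul, norm_inv, norm_norm, inv_mul_cancel₀ ha0]
    have hn2 : ‖‖c‖⁻¹ • c‖ = 1 := by rw [norm_smul, norm_inv, norm_norm, inv_mul_cancel₀ hc0]
    have hin : inner ℝ (‖a‖⁻¹ • a) (‖c‖⁻¹ • c) = (0 : ℝ) := by
      rw [inner_smul_left, inner_smul_right, hac, mul_zero, mul_zero]
    have hin' : inner ℝ (‖c‖⁻¹ • c) (‖a‖⁻¹ • a) = (0 : ℝ) := by rw [real_inner_comm, hin]
    refine ⟨?_, ?_⟩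
    · rintro ⟨i, rfl | rfl⟩
      · simpa [v] using hn1
      · simpa [v] using hn2
    · rintro ⟨i, rfl | rfl⟩ ⟨j, rfl | rfl⟩ hij
      · exact absurd rfl hij
      · simpa [v] using hin
      · simpa [v] using hin'
      · exact absurd rfl hij
  obtain ⟨B, hB⟩ := hv.exists_orthonormalBasis_extension_of_card_eq (by simp)
  have hB0 : B 0 = ‖a‖⁻¹ • a := by simpa [v] using hB 0 (by simp)
  have hB1 : B 1 = ‖c‖⁻¹ • c := by simpa [v] using hB 1 (by simp)
  refine ⟨B, ‖a‖, ‖c‖, by rw [hna, hnc]; ring, by rw [hna, hnc]; linarith, ?_, ?_⟩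
  · rw [hB0, hB1, smul_inv_smul₀ ha0, smul_inv_smul₀ hc0, ha, hc']
    module
  · rw [hB0, hB1, smul_inv_smul₀ ha0, smul_inv_smul₀ hc0, ha, hc']
    module

/-- The logarithmic Sobolev inequality for one pair of points, in mean over all isometries. -/
lemma IsInvariantFamily.lintegral_pair_le (hU : IsInvariantFamily P U) {k : E (n + 2) → ℝ}
    (hk : EvenHom k) (hpos : ∀ x, x ≠ 0 → 0 < k x) (σ τ : S (n + 2)) :
    n * ∫⁻ ξ, ENNReal.ofReal (jumpDensity k (U ξ σ) (U ξ τ)) ∂P ≤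
      ∫⁻ ξ, ENNReal.ofReal (1 / 4 * (k (U ξ σ) + k (U ξ τ)) *
        rotEnergy (fun x => Real.log (k x)) (U ξ σ) (U ξ τ)) ∂P := by
  -- by evenness it is enough to treat `τ · σ ≥ 0`
  wlog hc : 0 ≤ dot τ σ generalizing τ
  · have h1 : 0 ≤ dot (-τ) σ := by
      have : dot (-τ) σ = -dot τ σ := inner_neg_left _ _
      linarith
    have h2 := this (-τ) h1
    have h3 : ∀ i j x, rotDeriv (fun x => Real.log (k x)) i j (-x) =
        rotDeriv (fun x => Real.log (k x)) i j x := fun i j x =>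
      ((hk.log hpos).rotDeriv i j).neg_apply x
    have h4 : ((-τ : S (n + 2)) : E (n + 2)) = -(τ : E (n + 2)) := rfl
    simpa only [h4, map_neg, jumpDensity, hk.neg_apply, rotEnergy, h3] using h2
  rcases eq_or_ne σ τ with rfl | hne
  · simp [jumpDensity]
  obtain ⟨B, α, β, hαβ, hle, hσ, hτ⟩ := exists_symmetric_basis hne hc
  have hB := orthonormal_iff_ite.1 B.orthonormal
  have hU0 : ∀ ξ (x : S (n + 2)), U ξ x ≠ 0 := fun ξ x => by simpa using coe_S_ne_zero x
  have cU : ∀ x : E (n + 2), Continuous fun ξ => U ξ x := fun x =>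
    hU.continuous.comp (continuous_id.prodMk continuous_const)
  have hi : ∀ i : Fin n, ∫⁻ ξ, ENNReal.ofReal (jumpDensity k (U ξ σ) (U ξ τ)) ∂P ≤
      ∫⁻ ξ, ENNReal.ofReal (dirFisher k (U ξ σ) (U ξ τ) (U ξ (β • B i.succ.succ))) ∂P := by
    intro i
    have h01 : (0 : Fin (n + 2)) ≠ 1 := by simp
    have h1i : (1 : Fin (n + 2)) ≠ i.succ.succ := fun h =>
      Fin.succ_ne_zero i (Fin.succ_injective _ (Fin.succ_zero_eq_one.trans h)).symm
    have := hU.lintegral_jumpDensity_le hk hpos (m := B 0) (u := B 1) (e := B i.succ.succ)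
      (α := α) (β := β) (B.orthonormal.1 _) (B.orthonormal.1 _)
      (by rw [hB, if_neg h1i])
      (by rw [hB, if_neg h01.symm]) (by rw [hB, if_neg (Fin.succ_ne_zero _)])
      (by rw [← hσ]; exact coe_S_ne_zero σ)
    rwa [← hσ, ← hτ] at this
  have hm : ∀ i : Fin n, Measurable fun ξ =>
      ENNReal.ofReal (dirFisher k (U ξ σ) (U ξ τ) (U ξ (β • B i.succ.succ))) := fun i =>
    (hk.continuous_dirFisher hpos (cU σ) (fun ξ => hU0 ξ σ) (cU τ) (fun ξ => hU0 ξ τ)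
      (cU _)).measurable.ennreal_ofReal
  calc n * ∫⁻ ξ, ENNReal.ofReal (jumpDensity k (U ξ σ) (U ξ τ)) ∂P
      = ∑ _i : Fin n, ∫⁻ ξ, ENNReal.ofReal (jumpDensity k (U ξ σ) (U ξ τ)) ∂P := by simp
    _ ≤ ∑ i : Fin n, ∫⁻ ξ, ENNReal.ofReal
        (dirFisher k (U ξ σ) (U ξ τ) (U ξ (β • B i.succ.succ))) ∂P :=
        Finset.sum_le_sum fun i _ => hi i
    _ = ∫⁻ ξ, ∑ i : Fin n, ENNReal.ofReal
        (dirFisher k (U ξ σ) (U ξ τ) (U ξ (β • B i.succ.succ))) ∂P :=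
        (lintegral_finsetSum _ fun i _ => hm i).symm
    _ ≤ _ := by
        refine lintegral_mono fun ξ => ?_
        rw [← ENNReal.ofReal_sum_of_nonneg fun i _ => dirFisher_nonneg hpos (hU0 ξ σ) (hU0 ξ τ) _]
        refine ENNReal.ofReal_le_ofReal ?_
        have := sum_dirFisher_le hk hpos (σ := sphMap (U ξ) σ) (τ := sphMap (U ξ) τ)
          (B.map (U ξ)) hαβ hle (by simp [hσ]) (by simp [hτ])
        simpa only [coe_sphMap, OrthonormalBasis.map_apply, ← map_smul] using this

end Pair

/-! ### The logarithmic Sobolev inequality -/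

variable {d : ℕ} {b : ℝ → ℝ}

lemma rotEnergy_comm (h : E d → ℝ) (x y : E d) : rotEnergy h x y = rotEnergy h y x := by
  unfold rotEnergy
  congr 1
  refine Finset.sum_congr rfl fun i _ => Finset.sum_congr rfl fun j _ => ?_
  ring

/-- The inequality with the constant `d - 2`, for integrals of the rotational energy. -/
lemma lintegral_jumpDensity_le {n : ℕ} {k : E (n + 2) → ℝ} (hk : EvenHom k)
    (hpos : ∀ x, x ≠ 0 → 0 < k x) {w : ℝ → ℝ≥0∞} (hw : Measurable w) :
    n * ∫⁻ σ : S (n + 2), ∫⁻ τ : S (n + 2), ENNReal.ofReal (jumpDensity k σ τ) * w (dot τ σ)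
        ∂(surf (n + 2)) ∂(surf (n + 2)) ≤
      ∫⁻ σ : S (n + 2), ∫⁻ τ : S (n + 2), ENNReal.ofReal
        (1 / 2 * k σ * rotEnergy (fun x => Real.log (k x)) σ τ) * w (dot τ σ)
        ∂(surf (n + 2)) ∂(surf (n + 2)) := by
  set Q : E (n + 2) → E (n + 2) → ℝ := rotEnergy (fun x => Real.log (k x)) with hQ
  have hQ0 : ∀ x y, 0 ≤ Q x y := rotEnergy_nonneg _
  have hU := isInvariantFamily_haar (V := E (n + 2))
  have hP := isProbabilityMeasure_haar (V := E (n + 2))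
  set U : unitary (E (n + 2) →L[ℝ] E (n + 2)) → E (n + 2) ≃ₗᵢ[ℝ] E (n + 2) :=
    fun U => Unitary.linearIsometryEquiv U⁻¹
  set P := Measure.haarMeasure (⊤ : TopologicalSpace.PositiveCompacts
      (unitary (E (n + 2) →L[ℝ] E (n + 2))))
  have hkpos : ∀ σ : S (n + 2), 0 < k σ := fun σ => hpos _ (coe_S_ne_zero σ)
  have cfst : Continuous fun p : S (n + 2) × S (n + 2) => (p.1 : E (n + 2)) :=
    continuous_subtype_val.comp continuous_fst
  have csnd : Continuous fun p : S (n + 2) × S (n + 2) => (p.2 : E (n + 2)) :=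
    continuous_subtype_val.comp continuous_snd
  have ck1 : Continuous fun p : S (n + 2) × S (n + 2) => k p.1 := hk.continuous_coe.comp continuous_fst
  have ck2 : Continuous fun p : S (n + 2) × S (n + 2) => k p.2 := hk.continuous_coe.comp continuous_snd
  have cQ : Continuous fun p : S (n + 2) × S (n + 2) => Q p.1 p.2 :=
    continuous_rotEnergy (hk.log hpos)
  have mJ : Measurable fun p : S (n + 2) × S (n + 2) => ENNReal.ofReal (jumpDensity k p.1 p.2) :=
    (hk.continuous_jumpDensity hpos cfst (fun _ => coe_S_ne_zero _) csnd
      (fun _ => coe_S_ne_zero _)).measurable.ennreal_ofReal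
  have mL : Measurable fun p : S (n + 2) × S (n + 2) =>
      ENNReal.ofReal (1 / 4 * (k p.1 + k p.2) * Q p.1 p.2) :=
    ((continuous_const.mul (ck1.add ck2)).mul cQ).measurable.ennreal_ofReal
  have mw : Measurable fun p : S (n + 2) × S (n + 2) => w (dot p.2 p.1) :=
    hw.comp (continuous_dot.comp continuous_swap).measurable
  have mH : Measurable fun p : S (n + 2) × S (n + 2) =>
      ENNReal.ofReal (1 / 4 * k p.1 * Q p.1 p.2) * w (dot p.2 p.1) :=
    ((continuous_const.mul ck1).mul cQ).measurable.ennreal_ofReal.mul mw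
  have mH' : Measurable fun p : S (n + 2) × S (n + 2) =>
      ENNReal.ofReal (1 / 4 * k p.2 * Q p.1 p.2) * w (dot p.2 p.1) :=
    ((continuous_const.mul ck2).mul cQ).measurable.ennreal_ofReal.mul mw
  -- the two terms of `k σ + k τ` have the same contribution
  have hsym : ∫⁻ σ : S (n + 2), ∫⁻ τ : S (n + 2), ENNReal.ofReal (1 / 4 * k τ * Q σ τ) *
      w (dot τ σ) ∂(surf (n + 2)) ∂(surf (n + 2)) =
      ∫⁻ σ : S (n + 2), ∫⁻ τ : S (n + 2), ENNReal.ofReal (1 / 4 * k σ * Q σ τ) *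
      w (dot τ σ) ∂(surf (n + 2)) ∂(surf (n + 2)) := by
    rw [lintegral_lintegral_swap mH'.aemeasurable]
    refine lintegral_congr fun σ => lintegral_congr fun τ => ?_
    rw [hQ, rotEnergy_comm, dot_comm]
  calc n * ∫⁻ σ : S (n + 2), ∫⁻ τ : S (n + 2), ENNReal.ofReal (jumpDensity k σ τ) * w (dot τ σ)
        ∂(surf (n + 2)) ∂(surf (n + 2))
      = ∫⁻ σ : S (n + 2), ∫⁻ τ : S (n + 2), n * (∫⁻ ξ, ENNReal.ofReal
          (jumpDensity k (U ξ σ) (U ξ τ)) ∂P) * w (dot τ σ)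
          ∂(surf (n + 2)) ∂(surf (n + 2)) := by
        rw [hU.lintegral_pair_eq (W := fun σ τ => ENNReal.ofReal (jumpDensity k σ τ)) mJ hw,
          ← lintegral_const_mul' _ _ (ENNReal.natCast_ne_top n)]
        refine lintegral_congr fun σ => ?_
        rw [← lintegral_const_mul' _ _ (ENNReal.natCast_ne_top n)]
        refine lintegral_congr fun τ => ?_
        rw [mul_assoc]
        rfl
    _ ≤ ∫⁻ σ : S (n + 2), ∫⁻ τ : S (n + 2), (∫⁻ ξ, ENNReal.ofReal
          (1 / 4 * (k (U ξ σ) + k (U ξ τ)) * Q (U ξ σ) (U ξ τ)) ∂P) * w (dot τ σ)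
          ∂(surf (n + 2)) ∂(surf (n + 2)) :=
        lintegral_mono fun σ => lintegral_mono fun τ =>
          mul_le_mul_left (hU.lintegral_pair_le hk hpos σ τ) _
    _ = ∫⁻ σ : S (n + 2), ∫⁻ τ : S (n + 2), ENNReal.ofReal (1 / 4 * (k σ + k τ) * Q σ τ) *
          w (dot τ σ) ∂(surf (n + 2)) ∂(surf (n + 2)) :=
        (hU.lintegral_pair_eq
          (W := fun σ τ => ENNReal.ofReal (1 / 4 * (k σ + k τ) * Q σ τ)) mL hw).symm
    _ = ∫⁻ σ : S (n + 2), ∫⁻ τ : S (n + 2), (ENNReal.ofReal (1 / 4 * k σ * Q σ τ) * w (dot τ σ) +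
          ENNReal.ofReal (1 / 4 * k τ * Q σ τ) * w (dot τ σ))
          ∂(surf (n + 2)) ∂(surf (n + 2)) := by
        refine lintegral_congr fun σ => lintegral_congr fun τ => ?_
        have := hkpos σ
        have := hkpos τ
        have := hQ0 σ τ
        rw [← add_mul, ← ENNReal.ofReal_add (by positivity) (by positivity)]
        congr 2
        ring
    _ = ∫⁻ σ : S (n + 2), ∫⁻ τ : S (n + 2), (ENNReal.ofReal (1 / 4 * k σ * Q σ τ) * w (dot τ σ) +
          ENNReal.ofReal (1 / 4 * k σ * Q σ τ) * w (dot τ σ))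
          ∂(surf (n + 2)) ∂(surf (n + 2)) := by
        have h1 : ∀ σ : S (n + 2), Measurable fun τ : S (n + 2) =>
            ENNReal.ofReal (1 / 4 * k σ * Q σ τ) * w (dot τ σ) := fun σ =>
          mH.comp (measurable_const.prodMk measurable_id)
        simp only [lintegral_add_left (h1 _)]
        rw [lintegral_add_left mH.lintegral_prod_right', hsym,
          lintegral_add_left mH.lintegral_prod_right']
    _ = _ := by
        refine lintegral_congr fun σ => lintegral_congr fun τ => ?_
        have := hkpos σ
        have := hQ0 σ τ
        rw [← add_mul, ← ENNReal.ofReal_add (by positivity) (by positivity)]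
        congr 2
        ring

lemma log_eq_log_homExt {f : S d → ℝ} :
    (fun τ : S d => Real.log (f τ)) = fun τ : S d => Real.log (homExt f τ) := by
  funext τ
  rw [homExt_coe]

lemma homExt_pos {f : S d → ℝ} (hf : ∀ σ, 0 < f σ) (x : E d) (hx : x ≠ 0) : 0 < homExt f x := by
  rw [homExt_of_ne hx]
  exact hf _

lemma continuous_entropyIntegrand {f : S d → ℝ} (hf : EvenHom (homExt f)) (hpos : ∀ σ, 0 < f σ)
    (hb : IsKernel b) (hl : LevyCondition d b) : Continuous (entropyIntegrand b f) := by
  have h1 : Continuous f := by simpa only [homExt_coe] using hf.continuous_coe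
  have h2 := continuous_gammaSq (hf.log (homExt_pos hpos)) hb hl
  rw [← log_eq_log_homExt] at h2
  exact h2.mul h1

lemma integrable_entropyIntegrand {f : S d → ℝ} (hf : EvenHom (homExt f)) (hpos : ∀ σ, 0 < f σ)
    (hb : IsKernel b) (hl : LevyCondition d b) : Integrable (entropyIntegrand b f) (surf d) :=
  (continuous_entropyIntegrand hf hpos hb hl).integrable_of_hasCompactSupport
    (HasCompactSupport.of_compactSpace _)

lemma entropyIntegrand_nonneg {f : S d → ℝ} (hf : EvenHom (homExt f)) (hpos : ∀ σ, 0 < f σ)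
    (hb : IsKernel b) (hl : LevyCondition d b) (σ : S d) : 0 ≤ entropyIntegrand b f σ := by
  have h2 := gammaSq_nonneg (hf.log (homExt_pos hpos)) hb hl σ
  rw [← log_eq_log_homExt] at h2
  exact mul_nonneg h2 (hpos σ).le

lemma mul_jumpEnergy_le {n : ℕ} {f : S (n + 2) → ℝ} (hf : EvenHom (homExt f))
    (hpos : ∀ σ, 0 < f σ) (hb : IsKernel b) (hl : LevyCondition (n + 2) b) :
    n * jumpEnergy b f ≤ ENNReal.ofReal (∫ σ, entropyIntegrand b f σ ∂(surf (n + 2))) := by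
  have hpos' := homExt_pos hpos
  have h1 := lintegral_jumpDensity_le hf hpos' (w := fun c => ENNReal.ofReal (b c))
    hb.measurable.ennreal_ofReal
  have e1 : jumpEnergy b f = ∫⁻ σ : S (n + 2), ∫⁻ τ : S (n + 2),
      ENNReal.ofReal (jumpDensity (homExt f) σ τ) * ENNReal.ofReal (b (dot τ σ))
        ∂(surf (n + 2)) ∂(surf (n + 2)) := by
    refine lintegral_congr fun σ => lintegral_congr fun τ => ?_
    rw [← ENNReal.ofReal_mul (jumpDensity_nonneg hpos' (coe_S_ne_zero σ) (coe_S_ne_zero τ)),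
      jumpDensity, homExt_coe, homExt_coe]
  rw [e1]
  refine h1.trans_eq ?_
  rw [ofReal_integral_eq_lintegral_ofReal (integrable_entropyIntegrand hf hpos hb hl)
    (Eventually.of_forall (entropyIntegrand_nonneg hf hpos hb hl))]
  refine lintegral_congr fun σ => ?_
  have h2 := ofReal_gammaSq (hf.log hpos') hb hl σ
  rw [entropyIntegrand, mul_comm _ (f σ), ENNReal.ofReal_mul (hpos σ).le, log_eq_log_homExt, h2,
    ← lintegral_const_mul' _ _ ENNReal.ofReal_ne_top]
  refine lintegral_congr fun τ => ?_
  have h3 := rotEnergy_nonneg (fun x => Real.log (homExt f x)) σ τ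
  have h4 := hpos σ
  rw [← ENNReal.ofReal_mul h4.le, ← ENNReal.ofReal_mul (by rw [homExt_coe]; positivity), homExt_coe]
  congr 1
  ring

lemma logSobolev_iff (hb : IsKernel b) (hl : LevyCondition d b) (Λ : ℝ≥0∞) :
    LogSobolev d b Λ ↔ ∀ f : S d → ℝ, IsSmooth f → IsEven f → (∀ σ, 0 < f σ) →
      Λ * jumpEnergy b f ≤ ENNReal.ofReal (∫ σ, entropyIntegrand b f σ ∂(surf d)) := by
  refine forall_congr' fun f => forall_congr' fun hs => forall_congr' fun he =>
    forall_congr' fun hpos => ?_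
  have h0 : 0 ≤ ∫ σ, entropyIntegrand b f σ ∂(surf d) :=
    integral_nonneg fun σ => entropyIntegrand_nonneg (hs.evenHom he) hpos hb hl σ
  have h1 : ((∫ σ, entropyIntegrand b f σ ∂(surf d) : ℝ) : EReal) =
      ((ENNReal.ofReal (∫ σ, entropyIntegrand b f σ ∂(surf d)) : ℝ≥0∞) : EReal) := by
    rw [EReal.coe_ennreal_ofReal, max_eq_left h0]
  rw [h1, EReal.coe_ennreal_le_coe_ennreal_iff]

lemma logSobolev_optConst (hb : IsKernel b) (hl : LevyCondition d b) :
    LogSobolev d b (optConst d b) := by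
  rw [logSobolev_iff hb hl]
  intro f hs he hpos
  rw [optConst, ENNReal.sSup_mul]
  exact iSup₂_le fun Λ hΛ => (logSobolev_iff hb hl Λ).1 hΛ f hs he hpos

end

end SphereBoltzmann

/-- Lower bound for the log-Sobolev constant in dimension `d ≥ 3`. The first three conjuncts say that
the terms of the inequality are well defined (the principal values converge, `𝓑 g` has a gradient,
and the integral on the left is that of an integrable function); the last two say that the
inequality holds with `Λ_b`, which is the largest possible constant, and that `Λ_b ≥ d - 2`. -/
theorem theoremt (d : ℕ) (hd : 3 ≤ d) (b : ℝ → ℝ) (hb : IsKernel b)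
    (hlevy : LevyCondition d b) :
    (∀ g : S d → ℝ, IsSmooth g → IsEven g →
      ∀ σ, Tendsto (fun ε => truncB b ε g σ) (𝓝[>] (0 : ℝ))
        (𝓝 (opB b g σ))) ∧
    (∀ g : S d → ℝ, IsSmooth g → IsEven g →
      ∀ σ : S d, DifferentiableAt ℝ
        (homExt (opB b g)) (σ : E d)) ∧
    (∀ f : S d → ℝ, IsSmooth f → IsEven f →
      (∀ σ, 0 < f σ) →
      Integrable (entropyIntegrand b f) (surf d)) ∧
    IsGreatest {Λ : ℝ≥0∞ | LogSobolev d b Λ} (optConst d b) ∧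
    ((d - 2 : ℕ) : ℝ≥0∞) ≤ optConst d b := by
  have hext : ∀ g : S d → ℝ, (fun τ : S d => homExt g τ) = g := fun g =>
    funext fun τ => homExt_coe g τ
  refine ⟨fun g hs he σ => ?_, fun g hs he σ => ?_, fun f hs he hpos =>
    integrable_entropyIntegrand (hs.evenHom he) hpos hb hlevy,
    ⟨logSobolev_optConst hb hlevy, fun Λ hΛ => le_sSup hΛ⟩, le_sSup ?_⟩
  · have h1 := tendsto_truncB (hs.evenHom he) hb hlevy σ
    rwa [← opB_eq (hs.evenHom he) hb hlevy, hext] at h1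
  · have h1 := differentiableAt_opB (hs.evenHom he) hb hlevy σ
    rwa [hext] at h1
  · obtain ⟨n, rfl⟩ : ∃ n, d = n + 2 := ⟨d - 2, by omega⟩
    refine (logSobolev_iff hb hlevy _).2 fun f hs he hpos => ?_
    simpa using mul_jumpEnergy_le (hs.evenHom he) hpos hb hlevy
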